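/- Setting. Consider curves $\gamma:[0,L]\to\mathbb{R}^2$, $L>0$, with $\gamma(0)=\gamma(L)$, that are simple (injective on $[0,L)$), parametrized by arc length, of class $C^1([0,L])$ and piecewise $C^2([0,L])$. Let $\mathbf t=\gamma'$ be the tangent vector, let $\mathbf n$ be $\mathbf t$ rotated counterclockwise by $\pi/2$, and let $k$ be the signed curvature, $\mathbf t'=k\,\mathbf n$ (defined except at finitely many parameters). Assume that $k$ changes sign only finitely many times and that $\gamma$ is positively oriented, i.e. $\mathbf n$ points into the bounded open set $\Omega_\gamma$ enclosed by $\gamma$. The class $\mathcal K$ consists of the curves with $\gamma'(0)=\gamma'(L)$; the class $\mathcal C$ consists of the curves with $\gamma'(0)=-\gamma'(L)$ for which $\gamma'(L)$ points outside $\Omega_\gamma$ (an external cusp at $\gamma(0)=\gamma(L)$). For points $p,q$ on $\gamma$, the arc $\wideparen{pq}$ is the part of $\gamma$ travelled from $p$ to $q$ in the direction of the tangent (possibly through the base point $\gamma(0)=\gamma(L)$). An arc is convex (concave) if $k\ge 0$ ($k\le 0$) on it and $k$ does not vanish identically on it; for curves in $\mathcal C$, a convex or concave arc must not contain the cusp except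 possibly as an endpoint. A convex (concave) arc is maximal if no convex (concave) arc containing it has a strictly larger value of $\left|\int k\,ds\right|$. The class $\mathcal K_\pi$ consists of the curves in $\mathcal K$ all of whose maximal convex arcs satisfy $\int k\,ds>\pi$ and all of whose maximal concave arcs satisfy $0>\int k\,ds>-\pi$. The class $\mathcal C_\pi$ consists of the curves in $\mathcal C$ all of whose maximal convex arcs that do not have the cusp as an endpoint satisfy $\int k\,ds>\pi$ and all of whose maximal concave arcs satisfy $0>\int k\,ds>-\pi$. Lemma. Let $\gamma\in\mathcal K_\pi$, or let $\gamma\in\mathcal C_\pi$ and let $p$ not be the cusp. Let $\wideparen{pq}$ be an arc of $\gamma$ with $p\ne q$, and let $r$ be the tangent line to $\gamma$ at $p$. Assume that $q\in r$ and that all points of $\gamma$ which follow $p$ and precede $q$ lie in the open half-plane bounded by $r$ opposite to the one into which the normal $\mathbf n$ at $p$ points. Then $\frac{q-p}{|q-p|}$ is the tangent vector to $\gamma$ at $p$ (so it is not the opposite of the tangent vector). -/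

import Mathlib

open Set Filter Topology MeasureTheory

noncomputable section

namespace PlaneCurve

/-- The Euclidean plane. -/
abbrev Plane : Type := EuclideanSpace ℝ (Fin 2)

/-- Rotation of a vector by the angle `π / 2` in the counterclockwise direction. -/
def rot90 (v : Plane) : Plane := !₂[-(v 1), v 0]

/-! A curve `γ : [0, L] → ℝ²` is given by a function on `ℝ` of which only the values on `[0, L]`
are used. -/

/-- The tangent vector `γ'(s)`, `s ∈ [0, L]` (one-sided at the endpoints). -/
def tangent (γ : ℝ → Plane) (L s : ℝ) : Plane := derivWithin γ (Icc 0 L) s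

/-- The normal vector: the pair (tangent, normal) is positively oriented. -/
def normal (γ : ℝ → Plane) (L s : ℝ) : Plane := rot90 (tangent γ L s)

/-- The signed curvature `k` of a curve parametrized by arc length, `γ'' = k n`. At the finitely
many parameters where a piecewise `C²` curve has no second derivative its value is `0`, which
affects neither the integrals nor the sign conditions below. -/
def curvature (γ : ℝ → Plane) (L s : ℝ) : ℝ :=
  inner ℝ (derivWithin (tangent γ L) (Icc 0 L) s) (normal γ L s)

/-- The `L`-periodic function that agrees with `f` on `[0, L)`. It is used to travel along a
closed curve past its base point. -/
def periodize {α : Type*} (L : ℝ) (f : ℝ → α) (s : ℝ) : α := f (L * Int.fract (s / L))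

/-- The set `Ω_γ` enclosed by the curve: the points off the curve whose connected component in the
complement of the curve is bounded. -/
def enclosed (γ : ℝ → Plane) (L : ℝ) : Set Plane :=
  {x | x ∈ (γ '' Icc 0 L)ᶜ ∧ Bornology.IsBounded (connectedComponentIn (γ '' Icc 0 L)ᶜ x)}

/-- `γ` is of class `C²` on each closed piece of some finite partition of `[0, L]`. -/
def PiecewiseC2 (γ : ℝ → Plane) (L : ℝ) : Prop :=
  ∃ (n : ℕ) (t : ℕ → ℝ), t 0 = 0 ∧ t n = L ∧ (∀ i < n, t i < t (i + 1)) ∧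
    ∀ i < n, ContDiffOn ℝ 2 γ (Icc (t i) (t (i + 1)))

/-- The signed curvature changes sign only finitely many times: it has a weak sign on each piece
of some finite partition of `[0, L]`. -/
def FinitelyManySignChanges (γ : ℝ → Plane) (L : ℝ) : Prop :=
  ∃ (n : ℕ) (t : ℕ → ℝ), t 0 = 0 ∧ t n = L ∧ (∀ i < n, t i < t (i + 1)) ∧
    ∀ i < n, (∀ s ∈ Ioo (t i) (t (i + 1)), 0 ≤ curvature γ L s) ∨
      (∀ s ∈ Ioo (t i) (t (i + 1)), curvature γ L s ≤ 0)

/-- A curve `γ : [0, L] → ℝ²` with `γ(0) = γ(L)` that is simple, parametrized by arc length, of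
class `C¹([0, L])` and piecewise `C²([0, L])`, whose curvature changes sign only finitely many
times, and that is positively oriented: the normal points into the enclosed set. -/
structure IsAdmissible (γ : ℝ → Plane) (L : ℝ) : Prop where
  length_pos : 0 < L
  closes : γ 0 = γ L
  simple : InjOn γ (Ico 0 L)
  c1 : ContDiffOn ℝ 1 γ (Icc 0 L)
  arclength : ∀ s ∈ Icc 0 L, ‖tangent γ L s‖ = 1
  piecewise_c2 : PiecewiseC2 γ L
  sign_changes : FinitelyManySignChanges γ L
  positive : ∀ s ∈ Ioo 0 L, ∀ᶠ h : ℝ in 𝓝[>] 0, γ s + h • normal γ L s ∈ enclosed γ L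

/-- The class `K`: closed curves without a cusp. -/
structure MemK (γ : ℝ → Plane) (L : ℝ) : Prop extends IsAdmissible γ L where
  smooth_closing : tangent γ L 0 = tangent γ L L

/-- The class `C`: curves with an external cusp at `γ(0) = γ(L)`. -/
structure MemC (γ : ℝ → Plane) (L : ℝ) : Prop extends IsAdmissible γ L where
  cusp : tangent γ L 0 = -tangent γ L L
  external : ∀ᶠ h : ℝ in 𝓝[>] 0, γ L + h • tangent γ L L ∉ enclosed γ L

/-! The arc that starts in `p = γ(a)` and, following the orientation, ends in `q = γ(b)`, is
represented by the parameter interval `[a, b]` of the periodized curve. -/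

/-- The arcs of a closed curve: at most one full turn, the base point may lie inside. -/
def ArcK (L a b : ℝ) : Prop := a < b ∧ b ≤ a + L

/-- The arcs of a curve with a cusp at `γ(0) = γ(L)` that do not have the cusp inside. -/
def ArcC (L a b : ℝ) : Prop := 0 ≤ a ∧ a < b ∧ b ≤ L

/-- The total curvature (curvature integral) of an arc. -/
def arcCurvature (γ : ℝ → Plane) (L a b : ℝ) : ℝ := ∫ s in a..b, periodize L (curvature γ L) s

/-- Among the arcs in the family `A`: the curvature is nonnegative on the arc and does not vanish
identically. -/
def IsConvexArc (A : ℝ → ℝ → Prop) (γ : ℝ → Plane) (L a b : ℝ) : Prop :=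
  A a b ∧ (∀ s ∈ Ioo a b, 0 ≤ periodize L (curvature γ L) s) ∧
    ∃ s ∈ Ioo a b, periodize L (curvature γ L) s ≠ 0

/-- Among the arcs in the family `A`: the curvature is nonpositive on the arc and does not vanish
identically. -/
def IsConcaveArc (A : ℝ → ℝ → Prop) (γ : ℝ → Plane) (L a b : ℝ) : Prop :=
  A a b ∧ (∀ s ∈ Ioo a b, periodize L (curvature γ L) s ≤ 0) ∧
    ∃ s ∈ Ioo a b, periodize L (curvature γ L) s ≠ 0

/-- A convex arc that is contained in no convex arc of larger absolute total curvature. -/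
def IsMaximalConvexArc (A : ℝ → ℝ → Prop) (γ : ℝ → Plane) (L a b : ℝ) : Prop :=
  IsConvexArc A γ L a b ∧ ¬ ∃ a' b', a' ≤ a ∧ b ≤ b' ∧ IsConvexArc A γ L a' b' ∧
    |arcCurvature γ L a b| < |arcCurvature γ L a' b'|

/-- A concave arc that is contained in no concave arc of larger absolute total curvature. -/
def IsMaximalConcaveArc (A : ℝ → ℝ → Prop) (γ : ℝ → Plane) (L a b : ℝ) : Prop :=
  IsConcaveArc A γ L a b ∧ ¬ ∃ a' b', a' ≤ a ∧ b ≤ b' ∧ IsConcaveArc A γ L a' b' ∧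
    |arcCurvature γ L a b| < |arcCurvature γ L a' b'|

/-- The class `K_π`. -/
structure MemKpi (γ : ℝ → Plane) (L : ℝ) : Prop extends MemK γ L where
  convex_arcs : ∀ a b, IsMaximalConvexArc (ArcK L) γ L a b → Real.pi < arcCurvature γ L a b
  concave_arcs : ∀ a b, IsMaximalConcaveArc (ArcK L) γ L a b →
    -Real.pi < arcCurvature γ L a b ∧ arcCurvature γ L a b < 0

/-- The class `C_π`. A maximal convex arc is constrained only if it is not adjacent to the cusp,
that is, if neither of its endpoints is the cusp. -/
structure MemCpi (γ : ℝ → Plane) (L : ℝ) : Prop extends MemC γ L where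
  convex_arcs : ∀ a b, IsMaximalConvexArc (ArcC L) γ L a b → a ≠ 0 → b ≠ L →
    Real.pi < arcCurvature γ L a b
  concave_arcs : ∀ a b, IsMaximalConcaveArc (ArcC L) γ L a b →
    -Real.pi < arcCurvature γ L a b ∧ arcCurvature γ L a b < 0

end PlaneCurve

end

/-! Suppose that q lay behind p. Hopf's secant argument, known from the theorem of turning tangents,
then bounds the turning of the tangent on the arc. To parameters s < t in [a, b] assign the
direction of the chord from γ(s) to γ(t), and on the diagonal the tangent. If there is no cusp
inside, simplicity makes this a continuous nowhere zero function on a triangle, so it has a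
continuous angle. Along the leg s = a the chord starts as the tangent at p, stays below r and ends
opposite to that tangent: the angle falls by π. Along the leg t = b the chords to q point above r,
so the angle cannot end higher than -π. Hence the tangent turns by at most -π
(`exists_log_secant_turning_le`).

The conditions on maximal arcs forbid this: every arc without the cusp in its interior has ∫ k > -π
(`neg_pi_lt_arcCurvature`). A shortest arc violating the bound is not concave, since it would lie in
a maximal concave arc. So it contains, strictly inside, a maximal convex arc worth more than π, and
the two remaining pieces, being shorter, are each worth more than -π.

If the arc passes the cusp, the chord direction is discontinuous there. At an external cusp the
outgoing branch lies to the right of the incoming one (`exists_cusp_order`), so nearby chords never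
point along the normal of the outgoing tangent. This fixes the branch of the angle: the cusp counts
as a turn by +π (`turning_le_of_cusp`). The two smooth parts together would then turn by at most
-2π, although each turns by more than -π. -/

noncomputable section

namespace PlaneCurve

/-! ### Continuous angles -/

/-- A nowhere vanishing continuous function on a star-shaped set has a continuous logarithm. -/
theorem exists_continuousOn_log_of_starConvex {E : Type*} [NormedAddCommGroup E] [NormedSpace ℝ E]
    {S : Set E} {x₀ : E} (hS : StarConvex ℝ x₀ S) (hx₀ : x₀ ∈ S) {f : E → ℂ}
    (hf : ContinuousOn f S) (hne : ∀ x ∈ S, f x ≠ 0) :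
    ∃ g : E → ℂ, ContinuousOn g S ∧ ∀ x ∈ S, Complex.exp (g x) = f x := by
  classical
  have hmem : ∀ (u : unitInterval) (x : S), x₀ + (u : ℝ) • ((x : E) - x₀) ∈ S := fun u x => by
    have := hS x.2 (sub_nonneg.2 u.2.2) u.2.1 (sub_add_cancel _ _)
    convert this using 1
    module
  have hcont : Continuous fun p : unitInterval × S => f (x₀ + (p.1 : ℝ) • ((p.2 : E) - x₀)) := by
    refine hf.comp_continuous (by fun_prop) fun p => hmem p.1 p.2
  -- The contraction of `S` to `x₀` turns `f` into a homotopy starting at a constant. Its lift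
  -- through the covering `exp`, taken at time 1, is the logarithm.
  let H : C(unitInterval × S, {z : ℂ // z ≠ 0}) :=
    ⟨fun p => ⟨f (x₀ + (p.1 : ℝ) • ((p.2 : E) - x₀)), hne _ (hmem p.1 p.2)⟩,
      hcont.subtype_mk _⟩
  let F := Complex.isCoveringMap_exp.liftHomotopy H (.const _ (Complex.log (f x₀)))
    (fun a => by
      apply Subtype.ext
      simp [H, Complex.exp_log (hne _ hx₀)])
  have hF : ∀ p, Complex.exp (F p) = f (x₀ + (p.1 : ℝ) • ((p.2 : E) - x₀)) := fun p =>
    congrArg Subtype.val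
      (congrFun (Complex.isCoveringMap_exp.liftHomotopy_lifts H _ _) p)
  refine ⟨fun x => if h : x ∈ S then F (1, ⟨x, h⟩) else 0, ?_, fun x hx => ?_⟩
  · rw [continuousOn_iff_continuous_domRestrict]
    have : Continuous fun x : S => F (1, x) := by fun_prop
    convert this using 2 with x
    simp
  · simp only [hx, dif_pos]
    rw [hF]
    simp

/-- If the secants from the initial point (with angles `α`) point below the initial tangent, those
to the final point (with angles `β`) point above it, and the secant from the initial to the final
point is opposite to the initial tangent, then the tangent turns by at most `-π`. -/
theorem turning_le_neg_pi {a b : ℝ} (hab : a < b) {α β : ℝ → ℝ}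
    (hα : ContinuousOn α (Icc a b)) (hβ : ContinuousOn β (Icc a b)) (h0 : α a = 0)
    (hαβ : α b = β a) (hneg : ∀ t ∈ Ioo a b, Real.sin (α t) < 0)
    (hpos : ∀ t ∈ Ioo a b, 0 < Real.sin (β t)) (hcos : Real.cos (α b) = -1) :
    β b ≤ -Real.pi := by
  have hpi := Real.pi_pos
  -- The angle `α` starts at 0 and can neither pass -π nor enter (0, π), so it ends in [-π, 0],
  -- where cosine -1 leaves only -π.
  have h1 : -Real.pi ≤ α b := by
    by_contra! h
    obtain ⟨t, ht, hte⟩ := intermediate_value_Ioo' hab.le hα (show -Real.pi ∈ Ioo (α b) (α a) by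
      rw [h0]; exact ⟨h, by linarith⟩)
    have := hneg t ht
    simp [hte] at this
  have h2 : α b ≤ 0 := by
    by_contra! h
    have hm : 0 < min (α b) Real.pi := lt_min h hpi
    obtain ⟨t, ht, hte⟩ := intermediate_value_Ioo hab.le hα
      (show min (α b) Real.pi / 2 ∈ Ioo (α a) (α b) by
        rw [h0]; exact ⟨by linarith, by linarith [min_le_left (α b) Real.pi]⟩)
    have := hneg t ht
    rw [hte] at this
    have := Real.sin_pos_of_pos_of_lt_pi (x := min (α b) Real.pi / 2) (by linarith)
      (by linarith [min_le_right (α b) Real.pi])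
    linarith
  have h3 : α b = -Real.pi := by
    by_contra hne
    have h4 : -Real.pi < α b := lt_of_le_of_ne h1 (Ne.symm hne)
    have := Real.cos_lt_cos_of_nonneg_of_le_pi (x := -α b) (y := Real.pi) (by linarith) le_rfl
      (by linarith)
    rw [Real.cos_neg, Real.cos_pi, hcos] at this
    exact lt_irrefl _ this
  by_contra! h
  -- If `β` ended above its initial value -π, it would take the midpoint of -π and `min (β b) 0`,
  -- which lies in (-π, 0), where the sine is negative.
  have hm : -Real.pi < min (β b) 0 := lt_min h (by linarith)
  obtain ⟨t, ht, hte⟩ := intermediate_value_Ioo hab.le hβ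
    (show (min (β b) 0 - Real.pi) / 2 ∈ Ioo (β a) (β b) by
      rw [← hαβ, h3]; exact ⟨by linarith, by linarith [min_le_left (β b) 0]⟩)
  have := hpos t ht
  rw [hte] at this
  have := Real.sin_neg_of_neg_of_neg_pi_lt (x := (min (β b) 0 - Real.pi) / 2)
    (by linarith [min_le_right (β b) 0]) (by linarith)
  linarith

/-! ### Chords and Hopf's argument -/

/-- The direction of the chords of a curve, extended by the tangent vector to the diagonal. -/
def secant (Γ T : ℝ → ℂ) (p : ℝ × ℝ) : ℂ :=
  if p.1 = p.2 then T p.1 else (Γ p.2 - Γ p.1) / ((p.2 - p.1 : ℝ) : ℂ)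

theorem secant_self (Γ T : ℝ → ℂ) (s : ℝ) : secant Γ T (s, s) = T s := by simp [secant]

theorem secant_of_lt (Γ T : ℝ → ℂ) {s t : ℝ} (h : s < t) :
    secant Γ T (s, t) = (Γ t - Γ s) / ((t - s : ℝ) : ℂ) := by simp [secant, h.ne]

theorem continuousWithinAt_secant_of_lt {Γ : ℝ → ℂ} (T : ℝ → ℂ) {u v : ℝ}
    (hΓ : ContinuousOn Γ (Icc u v)) {s t : ℝ} (hs : s ∈ Icc u v) (ht : t ∈ Icc u v) (h : s < t) :
    ContinuousWithinAt (secant Γ T) (Icc u v ×ˢ Icc u v) (s, t) := by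
  have h1 : ContinuousWithinAt (fun p : ℝ × ℝ => (Γ p.2 - Γ p.1) / ((p.2 - p.1 : ℝ) : ℂ))
      (Icc u v ×ˢ Icc u v) (s, t) := by
    refine ContinuousWithinAt.div (ContinuousWithinAt.sub ?_ ?_) ?_ ?_
    · exact (hΓ t ht).comp continuousWithinAt_snd fun p hp => hp.2
    · exact (hΓ s hs).comp continuousWithinAt_fst fun p hp => hp.1
    · exact Continuous.continuousWithinAt (by fun_prop)
    · simpa [sub_eq_zero] using h.ne'
  refine h1.congr_of_eventuallyEq ?_ (secant_of_lt Γ T h)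
  refine Filter.Eventually.filter_mono nhdsWithin_le_nhds ?_
  filter_upwards [(isOpen_lt continuous_fst continuous_snd).mem_nhds (show ((s, t) : ℝ × ℝ) ∈
    {p : ℝ × ℝ | p.1 < p.2} from h)] with p hp
  exact secant_of_lt Γ T hp

/-- Mean value inequality: `Γ z - z * T s` has derivative `T z - T s`, which is small near `s`, so
all difference quotients near `s` are close to `T s`. -/
theorem continuousWithinAt_secant_self {Γ T : ℝ → ℂ} {u v : ℝ}
    (hΓ : ∀ s ∈ Icc u v, HasDerivWithinAt Γ (T s) (Icc u v) s) (hT : ContinuousOn T (Icc u v))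
    {s : ℝ} (hs : s ∈ Icc u v) :
    ContinuousWithinAt (secant Γ T) {p : ℝ × ℝ | u ≤ p.1 ∧ p.1 ≤ p.2 ∧ p.2 ≤ v} (s, s) := by
  rw [Metric.continuousWithinAt_iff]
  intro ε hε
  obtain ⟨δ, hδ, hd⟩ := Metric.continuousWithinAt_iff.1 (hT s hs) (ε / 2) (half_pos hε)
  refine ⟨δ, hδ, ?_⟩
  rintro ⟨x, y⟩ ⟨hx, hxy, hy⟩ hdist
  rw [Prod.dist_eq, max_lt_iff] at hdist
  rw [secant_self]
  rcases eq_or_lt_of_le (show x ≤ y from hxy) with rfl | hlt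
  · rw [secant_self]
    exact (hd ⟨hx, hy⟩ hdist.1).trans (half_lt_self hε)
  · rw [secant_of_lt Γ T hlt, dist_eq_norm]
    have hsub : Icc x y ⊆ Icc u v := Icc_subset_Icc hx hy
    have hbound : ∀ z ∈ Icc x y, ‖T z - T s‖ ≤ ε / 2 := fun z hz => by
      rw [← dist_eq_norm]
      refine (hd (hsub hz) ?_).le
      have h1 := abs_lt.1 hdist.1
      have h2 := abs_lt.1 hdist.2
      exact abs_lt.2 ⟨by linarith [hz.1, h1.1], by linarith [hz.2, h2.2]⟩
    have key := (convex_Icc x y).norm_image_sub_le_of_norm_hasDerivWithin_le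
      (f := fun z : ℝ => Γ z - (z : ℂ) * T s) (f' := fun z => T z - T s) (C := ε / 2)
      (fun z hz => by
        have h1 := (hΓ z (hsub hz)).mono hsub
        have h2 : HasDerivWithinAt (fun z : ℝ => (z : ℂ) * T s) (1 * T s) (Icc x y) z :=
          ((hasDerivAt_id z).ofReal_comp.mul_const (T s)).hasDerivWithinAt
        rw [one_mul] at h2
        exact h1.sub h2) hbound
      (left_mem_Icc.2 hlt.le) (right_mem_Icc.2 hlt.le)
    have hyx : ((y - x : ℝ) : ℂ) ≠ 0 := by exact_mod_cast (sub_pos.2 hlt).ne'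
    have : (Γ y - Γ x) / ((y - x : ℝ) : ℂ) - T s =
        ((Γ y - (y : ℂ) * T s) - (Γ x - (x : ℂ) * T s)) / ((y - x : ℝ) : ℂ) := by
      field_simp
      push_cast
      ring
    rw [this, norm_div, Complex.norm_real, Real.norm_eq_abs, abs_of_pos (sub_pos.2 hlt),
      div_lt_iff₀ (sub_pos.2 hlt)]
    rw [Real.norm_eq_abs, abs_of_pos (sub_pos.2 hlt)] at key
    nlinarith [sub_pos.2 hlt]

/-- Two continuous angle functions of the same directions differ by a constant. -/
theorem sub_eq_sub_of_exp_eq {θ ψ : ℝ → ℝ} {u v : ℝ} (huv : u ≤ v)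
    (hθ : ContinuousOn θ (Icc u v)) (hψ : ContinuousOn ψ (Icc u v))
    (h : ∀ s ∈ Icc u v, Complex.exp (θ s * Complex.I) = Complex.exp (ψ s * Complex.I)) :
    θ v - θ u = ψ v - ψ u := by
  have hint : ∀ s ∈ Icc u v, ∃ n : ℤ, θ s - ψ s = n * (2 * Real.pi) := fun s hs => by
    obtain ⟨n, hn⟩ := Complex.exp_eq_exp_iff_exists_int.1 (h s hs)
    refine ⟨n, ?_⟩
    have := congrArg Complex.im hn
    simp at this
    linarith
  have hc : ContinuousOn (fun s => (θ s - ψ s) / (2 * Real.pi)) (Icc u v) :=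
    (hθ.sub hψ).div_const _
  have hpi := Real.two_pi_pos.ne'
  have hconst := isPreconnected_Icc.constant_of_mapsTo (T := range ((↑) : ℤ → ℝ)) ?_ hc
    (fun s hs => by
      obtain ⟨n, hn⟩ := hint s hs
      exact ⟨n, by simp only [hn]; field_simp⟩) (left_mem_Icc.2 huv) (right_mem_Icc.2 huv)
  · have := (div_left_inj' hpi).1 hconst
    linarith
  · exact ⟨Int.isClosedEmbedding_coe_real.isEmbedding.toHomeomorph.symm.isEmbedding.discreteTopology⟩

/-- A set of pairs of parameters `s ≤ t` on which secants can be followed from the initial to the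
final tangent. -/
structure IsSecantDomain (a b : ℝ) (S : Set (ℝ × ℝ)) : Prop where
  starConvex : StarConvex ℝ (a, b) S
  subset : S ⊆ {p | a ≤ p.1 ∧ p.1 ≤ p.2 ∧ p.2 ≤ b}
  left_leg : ∀ t ∈ Icc a b, (a, t) ∈ S
  right_leg : ∀ s ∈ Icc a b, (s, b) ∈ S

/-- Hopf's argument: a curve that stays below its initial tangent and returns to it behind its
starting point turns by at most `-π`. -/
theorem exists_log_secant_turning_le {Γ T : ℝ → ℂ} {a b : ℝ} (hab : a < b) {S : Set (ℝ × ℝ)}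
    (hS : IsSecantDomain a b S) (hc : ContinuousOn (secant Γ T) S)
    (hT : ∀ s ∈ Icc a b, T s ≠ 0) (hinj : ∀ s ∈ Icc a b, ∀ t ∈ Icc a b, s < t → Γ s ≠ Γ t)
    (hside : ∀ t ∈ Ioo a b, ((Γ t - Γ a) / T a).im < 0) (him : ((Γ b - Γ a) / T a).im = 0)
    (hre : ((Γ b - Γ a) / T a).re < 0) :
    ∃ g : ℝ × ℝ → ℂ, ContinuousOn g S ∧ (∀ p ∈ S, Complex.exp (g p) = secant Γ T p) ∧
      (g (b, b)).im - (g (a, a)).im ≤ -Real.pi := by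
  obtain ⟨g, hg, hexp⟩ := exists_continuousOn_log_of_starConvex hS.starConvex
    (hS.left_leg b (right_mem_Icc.2 hab.le)) hc (by
      rintro ⟨s, t⟩ hp
      obtain ⟨h1, h2, h3⟩ := hS.subset hp
      rcases eq_or_lt_of_le (show s ≤ t from h2) with rfl | hlt
      · rw [secant_self]; exact hT s ⟨h1, h3⟩
      · rw [secant_of_lt Γ T hlt]
        refine div_ne_zero (sub_ne_zero.2 (hinj s ⟨h1, h2.trans h3⟩ t ⟨h1.trans h2, h3⟩ hlt).symm) ?_
        exact_mod_cast (sub_pos.2 hlt).ne')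
  refine ⟨g, hg, hexp, ?_⟩
  have hga : Complex.exp (g (a, a)) = T a := by
    rw [hexp _ (hS.left_leg a (left_mem_Icc.2 hab.le)), secant_self]
  -- Angles are measured from the initial tangent: after division by `T a`, the side of the tangent
  -- line becomes the sign of a sine.
  have key : ∀ s t, (s, t) ∈ S → s < t →
      Complex.exp (g (s, t) - g (a, a)) = (((t - s)⁻¹ : ℝ) : ℂ) * ((Γ t - Γ s) / T a) := by
    intro s t hst hlt
    rw [Complex.exp_sub, hexp _ hst, hga, secant_of_lt Γ T hlt, Complex.ofReal_inv]
    ring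
  have him' : ∀ s t, (s, t) ∈ S → s < t → Real.exp (g (s, t) - g (a, a)).re *
      Real.sin ((g (s, t)).im - (g (a, a)).im) = (t - s)⁻¹ * ((Γ t - Γ s) / T a).im := by
    intro s t hst hlt
    have := congrArg Complex.im (key s t hst hlt)
    rwa [Complex.exp_im, Complex.im_ofReal_mul] at this
  have hre' : ∀ s t, (s, t) ∈ S → s < t → Real.exp (g (s, t) - g (a, a)).re *
      Real.cos ((g (s, t)).im - (g (a, a)).im) = (t - s)⁻¹ * ((Γ t - Γ s) / T a).re := by
    intro s t hst hlt
    have := congrArg Complex.re (key s t hst hlt)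
    rwa [Complex.exp_re, Complex.re_ofReal_mul] at this
  have hleft := hS.left_leg
  have hright := hS.right_leg
  refine turning_le_neg_pi hab (α := fun t => (g (a, t)).im - (g (a, a)).im)
    (β := fun s => (g (s, b)).im - (g (a, a)).im) ?_ ?_ (sub_self _) rfl ?_ ?_ ?_
  · refine ContinuousOn.sub (Complex.continuous_im.comp_continuousOn ?_) continuousOn_const
    exact hg.comp (by fun_prop) hleft
  · refine ContinuousOn.sub (Complex.continuous_im.comp_continuousOn ?_) continuousOn_const
    exact hg.comp (by fun_prop) hright
  · intro t ht
    have h1 := him' a t (hleft t (Ioo_subset_Icc_self ht)) ht.1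
    have h2 := mul_neg_of_pos_of_neg (inv_pos.2 (sub_pos.2 ht.1)) (hside t ht)
    rw [← h1] at h2
    exact (pos_iff_neg_of_mul_neg h2).1 (Real.exp_pos _)
  · intro s hs
    have h1 := him' s b (hright s (Ioo_subset_Icc_self hs)) hs.2
    -- As `Γ b` lies on the initial tangent line, the chord to it rises by as much as its starting
    -- point lies below that line.
    have h3 : ((Γ b - Γ s) / T a).im = -((Γ s - Γ a) / T a).im := by
      have : (Γ b - Γ s) / T a = (Γ b - Γ a) / T a - (Γ s - Γ a) / T a := by ring
      rw [this, Complex.sub_im, him, zero_sub]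
    rw [h3] at h1
    have h2 := mul_pos (inv_pos.2 (sub_pos.2 hs.2)) (neg_pos.2 (hside s hs))
    rw [← h1] at h2
    exact (pos_iff_pos_of_mul_pos h2).1 (Real.exp_pos _)
  · have hm := hleft b (right_mem_Icc.2 hab.le)
    have h1 := him' a b hm hab
    have h2 := hre' a b hm hab
    rw [him, mul_zero] at h1
    have hs0 := (mul_eq_zero.1 h1).resolve_left (Real.exp_pos _).ne'
    have h3 := mul_neg_of_pos_of_neg (inv_pos.2 (sub_pos.2 hab)) hre
    rw [← h2] at h3
    have hc0 := (pos_iff_neg_of_mul_neg h3).1 (Real.exp_pos _)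
    have := Real.sin_sq_add_cos_sq ((g (a, b)).im - (g (a, a)).im)
    show Real.cos ((g (a, b)).im - (g (a, a)).im) = -1
    rw [hs0] at this
    nlinarith

theorem exp_im_mul_I_of_norm_exp_eq_one {z : ℂ} (h : ‖Complex.exp z‖ = 1) :
    Complex.exp (z.im * Complex.I) = Complex.exp z := by
  rw [Complex.norm_exp, Real.exp_eq_one_iff] at h
  congr 1
  apply Complex.ext <;> simp [h]

/-- Along the diagonal a continuous logarithm of the secants follows the tangent angle. -/
theorem im_log_secant_diagonal {Γ T : ℝ → ℂ} {S : Set (ℝ × ℝ)} {g : ℝ × ℝ → ℂ}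
    (hg : ContinuousOn g S) (hexp : ∀ p ∈ S, Complex.exp (g p) = secant Γ T p) {u v : ℝ}
    (huv : u ≤ v) (hS : ∀ s ∈ Icc u v, (s, s) ∈ S) {Θ : ℝ → ℝ} (hΘ : ContinuousOn Θ (Icc u v))
    (τ : ℝ) (hT : ∀ s ∈ Icc u v, T s = Complex.exp (((Θ s + τ : ℝ) : ℂ) * Complex.I)) :
    (g (v, v)).im - (g (u, u)).im = Θ v - Θ u := by
  have := sub_eq_sub_of_exp_eq huv (θ := fun s => (g (s, s)).im) (ψ := fun s => Θ s + τ)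
    (Complex.continuous_im.comp_continuousOn (hg.comp (by fun_prop) hS))
    (hΘ.add continuousOn_const) (fun s hs => by
      have h := hexp _ (hS s hs)
      rw [secant_self, hT s hs] at h
      rw [← h]
      apply exp_im_mul_I_of_norm_exp_eq_one
      rw [h, Complex.norm_exp_ofReal_mul_I])
  simpa using this

theorem isSecantDomain_triangle {a b : ℝ} :
    IsSecantDomain a b {p | a ≤ p.1 ∧ p.1 ≤ p.2 ∧ p.2 ≤ b} where
  starConvex := by
    rintro ⟨s, t⟩ ⟨h1, h2, h3⟩ x y hx hy hxy
    obtain rfl : x = 1 - y := by linarith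
    simp only [mem_ofPred_eq, Prod.fst_add, Prod.snd_add, Prod.smul_fst, Prod.smul_snd,
      smul_eq_mul] at *
    refine ⟨?_, ?_, ?_⟩ <;> nlinarith
  subset := subset_rfl
  left_leg := fun t ht => ⟨le_rfl, ht.1, ht.2⟩
  right_leg := fun s hs => ⟨hs.1, hs.2, le_rfl⟩

/-- The notch `u < s`, `t < v` will hide a cusp, where secants are discontinuous. Moving towards
`(a, b)` decreases `s` and increases `t`, so it never enters the notch. -/
theorem isSecantDomain_notched_triangle {a b u v : ℝ} (hu : a ≤ u) (hv : v ≤ b) :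
    IsSecantDomain a b {p | (a ≤ p.1 ∧ p.1 ≤ p.2 ∧ p.2 ≤ b) ∧ (p.1 ≤ u ∨ v ≤ p.2)} where
  starConvex := by
    rintro ⟨s, t⟩ ⟨h, h'⟩ x y hx hy hxy
    refine ⟨isSecantDomain_triangle.starConvex h hx hy hxy, ?_⟩
    obtain ⟨h1, h2, h3⟩ := h
    obtain rfl : x = 1 - y := by linarith
    simp only [Prod.fst_add, Prod.snd_add, Prod.smul_fst, Prod.smul_snd,
      smul_eq_mul] at *
    refine h'.imp (fun h => ?_) (fun h => ?_) <;> nlinarith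
  subset := fun p hp => hp.1
  left_leg := fun t ht => ⟨⟨le_rfl, ht.1, ht.2⟩, Or.inl hu⟩
  right_leg := fun s hs => ⟨⟨hs.1, hs.2, le_rfl⟩, Or.inr hv⟩

/-- Hopf's argument for a curve with continuous tangent angle `Θ`. -/
theorem turning_le_of_smooth {Γ T : ℝ → ℂ} {a b : ℝ} (hab : a < b) (hT : ∀ s ∈ Icc a b, T s ≠ 0)
    (hΓ : ∀ s ∈ Icc a b, HasDerivWithinAt Γ (T s) (Icc a b) s)
    (hinj : ∀ s ∈ Icc a b, ∀ t ∈ Icc a b, s < t → Γ s ≠ Γ t)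
    (hside : ∀ t ∈ Ioo a b, ((Γ t - Γ a) / T a).im < 0) (him : ((Γ b - Γ a) / T a).im = 0)
    (hre : ((Γ b - Γ a) / T a).re < 0) {Θ : ℝ → ℝ} (hΘ : ContinuousOn Θ (Icc a b)) (τ : ℝ)
    (hTΘ : ∀ s ∈ Icc a b, T s = Complex.exp (((Θ s + τ : ℝ) : ℂ) * Complex.I)) :
    Θ b - Θ a ≤ -Real.pi := by
  have hTc : ContinuousOn T (Icc a b) := by
    refine ContinuousOn.congr ?_ hTΘ
    fun_prop
  have hc : ContinuousOn (secant Γ T) {p | a ≤ p.1 ∧ p.1 ≤ p.2 ∧ p.2 ≤ b} := by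
    rintro ⟨s, t⟩ ⟨h1, h2, h3⟩
    simp only at h1 h2 h3
    rcases eq_or_lt_of_le h2 with rfl | hlt
    · exact continuousWithinAt_secant_self hΓ hTc ⟨h1, h3⟩
    · refine (continuousWithinAt_secant_of_lt T (fun s hs => (hΓ s hs).continuousWithinAt)
        ⟨h1, h2.trans h3⟩ ⟨h1.trans h2, h3⟩ hlt).mono ?_
      rintro ⟨x, y⟩ ⟨h1, h2, h3⟩
      exact ⟨⟨h1, h2.trans h3⟩, ⟨h1.trans h2, h3⟩⟩
  obtain ⟨g, hg, hexp, hle⟩ := exists_log_secant_turning_le hab isSecantDomain_triangle hc hT hinj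
    hside him hre
  rwa [im_log_secant_diagonal hg hexp hab.le (fun s hs => ⟨hs.1, le_rfl, hs.2⟩) hΘ τ hTΘ] at hle

/-! ### Hopf's argument across a cusp -/

/-- A continuous angle that avoids the direction `i` stays in one branch of the argument. -/
theorem angle_mem_Ioo_of_avoids {θ : ℝ → ℝ} {u v : ℝ} (huv : u ≤ v)
    (hθ : ContinuousOn θ (Icc u v))
    (hav : ∀ s ∈ Icc u v, ¬ (Real.cos (θ s) = 0 ∧ 0 < Real.sin (θ s))) (n : ℤ)
    (hu : θ u ∈ Ioo (Real.pi / 2 + n * (2 * Real.pi)) (5 * Real.pi / 2 + n * (2 * Real.pi))) :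
    θ v ∈ Ioo (Real.pi / 2 + n * (2 * Real.pi)) (5 * Real.pi / 2 + n * (2 * Real.pi)) := by
  have h5 : 5 * Real.pi / 2 + n * (2 * Real.pi) =
      Real.pi / 2 + ((n + 1 : ℤ) : ℝ) * (2 * Real.pi) := by push_cast; ring
  have hno : ∀ (m : ℤ), ∀ s ∈ Icc u v, θ s ≠ Real.pi / 2 + m * (2 * Real.pi) := by
    intro m s hs h
    apply hav s hs
    rw [h, Real.cos_add_int_mul_two_pi, Real.sin_add_int_mul_two_pi]
    simp
  constructor
  · by_contra! h
    obtain ⟨s, hs, hse⟩ := intermediate_value_Icc' huv hθ ⟨h, hu.1.le⟩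
    exact hno n s hs hse
  · by_contra! h
    obtain ⟨s, hs, hse⟩ := intermediate_value_Icc huv hθ ⟨hu.2.le, h⟩
    exact hno (n + 1) s hs (hse.trans h5)

/-- Hopf's argument for a curve with a cusp at `c`, where the tangent angle jumps from `π` to `2π`
and no chord nearby points to the left of the outgoing tangent. -/
theorem turning_le_of_cusp {Γ T : ℝ → ℂ} {a b c : ℝ} (hac : a < c) (hcb : c < b)
    (hT : ∀ s ∈ Icc a b, T s ≠ 0) (hΓc : ContinuousOn Γ (Icc a b))
    (hΓ₁ : ∀ u < c, ∀ s ∈ Icc a u, HasDerivWithinAt Γ (T s) (Icc a u) s)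
    (hΓ₂ : ∀ s ∈ Icc c b, HasDerivWithinAt Γ (T s) (Icc c b) s)
    (hinj : ∀ s ∈ Icc a b, ∀ t ∈ Icc a b, s < t → Γ s ≠ Γ t)
    (hside : ∀ t ∈ Ioo a b, ((Γ t - Γ a) / T a).im < 0) (him : ((Γ b - Γ a) / T a).im = 0)
    (hre : ((Γ b - Γ a) / T a).re < 0) {Θ₁ Θ₂ : ℝ → ℝ} (hΘ₁ : ContinuousOn Θ₁ (Icc a c))
    (hΘ₂ : ContinuousOn Θ₂ (Icc c b)) (τ : ℝ)
    (hTΘ₁ : ∀ s ∈ Ico a c, T s = Complex.exp (((Θ₁ s + τ : ℝ) : ℂ) * Complex.I))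
    (hTΘ₂ : ∀ s ∈ Icc c b, T s = Complex.exp (((Θ₂ s + τ : ℝ) : ℂ) * Complex.I))
    (h₁ : Θ₁ c = Real.pi) (h₂ : Θ₂ c = 2 * Real.pi)
    (hext : ∃ ε > 0, ∀ s ∈ Icc (c - ε) (c + ε), ∀ t ∈ Icc (c - ε) (c + ε), s < t →
      ¬ (((Γ t - Γ s) / T c).re = 0 ∧ 0 < ((Γ t - Γ s) / T c).im)) :
    Θ₂ b - Θ₁ a ≤ -Real.pi := by
  have hpi := Real.pi_pos
  obtain ⟨ε₀, hε₀, hext⟩ := hext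
  obtain ⟨δ₁, hδ₁, hd₁⟩ := Metric.continuousWithinAt_iff.1 (hΘ₁ c (right_mem_Icc.2 hac.le))
    (Real.pi / 2) (by positivity)
  obtain ⟨δ₂, hδ₂, hd₂⟩ := Metric.continuousWithinAt_iff.1 (hΘ₂ c (left_mem_Icc.2 hcb.le))
    (Real.pi / 2) (by positivity)
  -- So small that the tangent angles at `c - ε` and `c + ε` are within π/2 of their limits π and
  -- 2π, and that `hext` covers all chords between.
  obtain ⟨ε, hε, hεlt⟩ := exists_between (show (0 : ℝ) < min (min ε₀ (min δ₁ δ₂))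
    (min (c - a) (b - c)) from lt_min (lt_min hε₀ (lt_min hδ₁ hδ₂))
      (lt_min (sub_pos.2 hac) (sub_pos.2 hcb)))
  simp only [lt_min_iff] at hεlt
  obtain ⟨⟨hε0, hε1, hε2⟩, hεa, hεb⟩ := hεlt
  obtain ⟨u, hu⟩ : ∃ u, u = c - ε := ⟨_, rfl⟩
  obtain ⟨v, hv⟩ : ∃ v, v = c + ε := ⟨_, rfl⟩
  have hau : a ≤ u := by linarith
  have hvb : v ≤ b := by linarith
  have huc : u < c := by linarith
  have hcv : c < v := by linarith
  have hΘu : |Θ₁ u - Real.pi| < Real.pi / 2 := by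
    have := hd₁ ⟨hau, huc.le⟩ (by rw [Real.dist_eq, abs_lt]; constructor <;> linarith)
    rwa [Real.dist_eq, h₁] at this
  have hΘv : |Θ₂ v - 2 * Real.pi| < Real.pi / 2 := by
    rw [← h₂]
    exact hd₂ ⟨hcv.le, hvb⟩ (by rw [Real.dist_eq, abs_lt]; constructor <;> linarith)
  rw [abs_lt] at hΘu hΘv
  set S : Set (ℝ × ℝ) := {p | (a ≤ p.1 ∧ p.1 ≤ p.2 ∧ p.2 ≤ b) ∧ (p.1 ≤ u ∨ v ≤ p.2)} with hSdef
  have hS : IsSecantDomain a b S := isSecantDomain_notched_triangle hau hvb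
  have hΘ₁' : ∀ w < c, ContinuousOn T (Icc a w) := fun w hw => by
    have : ContinuousOn Θ₁ (Icc a w) := hΘ₁.mono (Icc_subset_Icc_right hw.le)
    refine ContinuousOn.congr ?_ (fun s hs => hTΘ₁ s ⟨hs.1, hs.2.trans_lt hw⟩)
    fun_prop
  have hΘ₂' : ContinuousOn T (Icc c b) := by
    refine ContinuousOn.congr ?_ hTΘ₂
    fun_prop
  have hc : ContinuousOn (secant Γ T) S := by
    rintro ⟨s, t⟩ ⟨⟨h1, h2, h3⟩, h4⟩
    simp only at h1 h2 h3 h4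
    rcases eq_or_lt_of_le h2 with rfl | hlt
    · rcases h4 with h4 | h4
      · obtain ⟨w, huw, hwc⟩ := exists_between huc
        have := continuousWithinAt_secant_self (hΓ₁ w hwc) (hΘ₁' w hwc) ⟨h1, h4.trans huw.le⟩
        refine this.mono_of_mem_nhdsWithin ?_
        filter_upwards [self_mem_nhdsWithin, mem_nhdsWithin_of_mem_nhds
          ((isOpen_lt continuous_snd continuous_const).mem_nhds
          (show ((s, s) : ℝ × ℝ) ∈ {p : ℝ × ℝ | p.2 < w} from h4.trans_lt huw))] with p hp hp'
        exact ⟨hp.1.1, hp.1.2.1, le_of_lt hp'⟩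
      · have := continuousWithinAt_secant_self hΓ₂ hΘ₂' ⟨hcv.le.trans h4, h3⟩
        refine this.mono_of_mem_nhdsWithin ?_
        filter_upwards [self_mem_nhdsWithin, mem_nhdsWithin_of_mem_nhds
          ((isOpen_lt continuous_const continuous_fst).mem_nhds
          (show ((s, s) : ℝ × ℝ) ∈ {p : ℝ × ℝ | c < p.1} from hcv.trans_le h4))] with p hp hp'
        exact ⟨le_of_lt hp', hp.1.2.1, hp.1.2.2⟩
    · refine (continuousWithinAt_secant_of_lt T hΓc
        ⟨h1, h2.trans h3⟩ ⟨h1.trans h2, h3⟩ hlt).mono ?_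
      rintro ⟨x, y⟩ ⟨⟨h1, h2, h3⟩, -⟩
      exact ⟨⟨h1, h2.trans h3⟩, ⟨h1.trans h2, h3⟩⟩
  obtain ⟨g, hg, hexp, hle⟩ := exists_log_secant_turning_le (hac.trans hcb) hS hc hT hinj
    hside him hre
  have e1 := im_log_secant_diagonal hg hexp hau
    (fun s hs => ⟨⟨hs.1, le_rfl, hs.2.trans (by linarith)⟩, Or.inl hs.2⟩)
    (hΘ₁.mono (Icc_subset_Icc_right huc.le)) τ (fun s hs => hTΘ₁ s ⟨hs.1, hs.2.trans_lt huc⟩)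
  have e2 := im_log_secant_diagonal hg hexp hvb
    (fun s hs => ⟨⟨by linarith [hs.1], le_rfl, hs.2⟩, Or.inr hs.1⟩)
    (hΘ₂.mono (Icc_subset_Icc_left hcv.le)) τ (fun s hs => hTΘ₂ s ⟨hcv.le.trans hs.1, hs.2⟩)
  have hTc : T c = Complex.exp ((τ : ℂ) * Complex.I) := by
    rw [hTΘ₂ c (left_mem_Icc.2 hcb.le), h₂, Complex.exp_eq_exp_iff_exists_int]
    exact ⟨1, by push_cast; ring⟩
  have huS : (u, u) ∈ S := ⟨⟨hau, le_rfl, by linarith⟩, Or.inl le_rfl⟩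
  have hvS : (v, v) ∈ S := ⟨⟨by linarith, le_rfl, hvb⟩, Or.inr le_rfl⟩
  have hshift : ∀ w, (w, w) ∈ S → ∀ x : ℝ, T w = Complex.exp (((x + τ : ℝ) : ℂ) * Complex.I) →
      ∃ n : ℤ, (g (w, w)).im - τ = x + n * (2 * Real.pi) := by
    intro w hw x hx
    have h := hexp _ hw
    rw [secant_self, hx] at h
    obtain ⟨n, hn⟩ := Complex.exp_eq_exp_iff_exists_int.1 h
    refine ⟨n, ?_⟩
    have := congrArg Complex.im hn
    simp at this
    linarith
  obtain ⟨n, hn⟩ := hshift u huS _ (hTΘ₁ u ⟨hau, huc⟩)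
  obtain ⟨m, hm⟩ := hshift v hvS _ (hTΘ₂ v ⟨hcv.le, hvb⟩)
  have havoid : ∀ s t, (s, t) ∈ S → s ∈ Icc u v → t ∈ Icc u v → s < t →
      ¬ (Real.cos ((g (s, t)).im - τ) = 0 ∧ 0 < Real.sin ((g (s, t)).im - τ)) := by
    rintro s t hst hs ht hlt ⟨h1, h2⟩
    have hk : Complex.exp (g (s, t) - τ * Complex.I) =
        (((t - s)⁻¹ : ℝ) : ℂ) * ((Γ t - Γ s) / T c) := by
      rw [Complex.exp_sub, hexp _ hst, secant_of_lt Γ T hlt, Complex.ofReal_inv, hTc]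
      ring
    have hIm : (g (s, t) - τ * Complex.I).im = (g (s, t)).im - τ := by simp
    have k1 := congrArg Complex.re hk
    have k2 := congrArg Complex.im hk
    rw [Complex.exp_re, Complex.re_ofReal_mul, hIm, h1, mul_zero] at k1
    rw [Complex.exp_im, Complex.im_ofReal_mul, hIm] at k2
    have hpos := inv_pos.2 (sub_pos.2 hlt)
    refine hext s ⟨by linarith [hs.1], by linarith [hs.2]⟩ t
      ⟨by linarith [ht.1], by linarith [ht.2]⟩ hlt ⟨?_, ?_⟩
    · exact (mul_eq_zero.1 k1.symm).resolve_left hpos.ne'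
    · refine (pos_iff_pos_of_mul_pos (a := (t - s)⁻¹) ?_).1 hpos
      rw [← k2]
      exact mul_pos (Real.exp_pos _) h2
  have hdiag : ∀ x : ℝ, ∀ k : ℤ, Real.cos x ≠ 0 →
      ¬ (Real.cos (x + k * (2 * Real.pi)) = 0 ∧ 0 < Real.sin (x + k * (2 * Real.pi))) := by
    rintro x k hx ⟨h, -⟩
    rw [Real.cos_add_int_mul_two_pi] at h
    exact hx h
  have hcu : Real.cos (Θ₁ u) ≠ 0 :=
    (Real.cos_neg_of_pi_div_two_lt_of_lt (by linarith) (by linarith)).ne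
  have hcv' : Real.cos (Θ₂ v) ≠ 0 := by
    rw [← Real.cos_sub_two_pi]
    exact (Real.cos_pos_of_mem_Ioo ⟨by linarith, by linarith⟩).ne'
  have hvert : ∀ t ∈ Icc u v, (u, t) ∈ S := fun t ht =>
    ⟨⟨hau, ht.1, ht.2.trans hvb⟩, Or.inl le_rfl⟩
  have hhor : ∀ s ∈ Icc u v, (s, v) ∈ S := fun s hs =>
    ⟨⟨hau.trans hs.1, hs.2, hvb⟩, Or.inr le_rfl⟩
  have huv : u ≤ v := by linarith
  -- Around the notch, from `(u, u)` over `(u, v)` to `(v, v)`, the chord never has the direction `I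
  -- * T c`. So its angle stays in one translate of (π/2, 5π/2), an interval containing both `Θ₁ u`
  -- and `Θ₂ v`.
  have step1 := angle_mem_Ioo_of_avoids (θ := fun t => (g (u, t)).im - τ) huv
    (ContinuousOn.sub (Complex.continuous_im.comp_continuousOn (hg.comp (by fun_prop) hvert))
      continuousOn_const)
    (fun t ht => by
      rcases eq_or_lt_of_le ht.1 with rfl | hlt
      · simp only [hn]
        exact hdiag _ n hcu
      · exact havoid u t (hvert t ht) (left_mem_Icc.2 huv) ht hlt) n
    (by simp only [hn]; constructor <;> linarith)
  have step2 := angle_mem_Ioo_of_avoids (θ := fun s => (g (s, v)).im - τ) huv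
    (ContinuousOn.sub (Complex.continuous_im.comp_continuousOn (hg.comp (by fun_prop) hhor))
      continuousOn_const)
    (fun s hs => by
      rcases eq_or_lt_of_le hs.2 with rfl | hlt
      · simp only [hm]
        exact hdiag _ m hcv'
      · exact havoid s v (hhor s hs) hs (right_mem_Icc.2 huv) hlt) n step1
  simp only [hm] at step2
  -- As `Θ₂ v` lies in (3π/2, 5π/2), only `m = n` keeps it in the branch; the jump at the cusp is
  -- therefore +π and no other odd multiple of π.
  have hmn : m = n := by
    have h1 : ((n - 1 : ℤ) : ℝ) < m := by push_cast; nlinarith [step2.1]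
    have h2 : (m : ℝ) < ((n + 1 : ℤ) : ℝ) := by push_cast; nlinarith [step2.2]
    have h1' := Int.cast_lt.1 h1
    have h2' := Int.cast_lt.1 h2
    omega
  rw [hmn] at hm
  linarith

/-! ### Maximal arcs and the lower bound for the total curvature -/

/-- The properties of the families `ArcK L` and `ArcC L` that give maximal arcs. -/
structure IsArcFamily (A : ℝ → ℝ → Prop) : Prop where
  sub : ∀ {a b x y}, A a b → a ≤ x → x < y → y ≤ b → A x y
  isCompact : ∀ x y, x < y → IsCompact {p : ℝ × ℝ | p.1 ≤ x ∧ y ≤ p.2 ∧ A p.1 p.2}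

/-- The strict inequality in `ArcK` is not closed, but it follows from `c ≤ x < y ≤ d`; the bound by
one full turn then confines both endpoints. -/
theorem isArcFamily_arcK (L : ℝ) : IsArcFamily (ArcK L) where
  sub := fun h hx hxy hy => ⟨hxy, by linarith [h.2]⟩
  isCompact := fun x y hxy => by
    have : {p : ℝ × ℝ | p.1 ≤ x ∧ y ≤ p.2 ∧ ArcK L p.1 p.2} =
        (Icc (y - L) x ×ˢ Icc y (x + L)) ∩ {p | p.2 ≤ p.1 + L} := by
      ext ⟨c, d⟩
      simp only [ArcK, mem_ofPred_eq, mem_inter_iff, mem_prod, mem_Icc]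
      constructor
      · rintro ⟨h1, h2, h3, h4⟩
        exact ⟨⟨⟨by linarith, h1⟩, h2, by linarith⟩, h4⟩
      · rintro ⟨⟨⟨h1, h2⟩, h3, h4⟩, h5⟩
        exact ⟨h2, h3, by linarith, h5⟩
    rw [this]
    exact (isCompact_Icc.prod isCompact_Icc).inter_right
      (isClosed_le continuous_snd (by fun_prop))

theorem isArcFamily_arcC (L : ℝ) : IsArcFamily (ArcC L) where
  sub := fun h hx hxy hy => ⟨h.1.trans hx, hxy, hy.trans h.2.2⟩
  isCompact := fun x y hxy => by
    have : {p : ℝ × ℝ | p.1 ≤ x ∧ y ≤ p.2 ∧ ArcC L p.1 p.2} = Icc 0 x ×ˢ Icc y L := by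
      ext ⟨c, d⟩
      simp only [ArcC, mem_ofPred_eq, mem_prod, mem_Icc]
      constructor
      · rintro ⟨h1, h2, h3, h4, h5⟩
        exact ⟨⟨h3, h1⟩, h2, h5⟩
      · rintro ⟨⟨h1, h2⟩, h3, h4⟩
        exact ⟨h2, h3, h1, by linarith, h4⟩
    rw [this]
    exact isCompact_Icc.prod isCompact_Icc

section
variable {γ : ℝ → Plane} {L : ℝ}

theorem arcCurvature_add
    (hint : ∀ a b, IntervalIntegrable (periodize L (curvature γ L)) volume a b) (a b c : ℝ) :
    arcCurvature γ L a b + arcCurvature γ L b c = arcCurvature γ L a c :=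
  intervalIntegral.integral_add_adjacent_intervals (hint a b) (hint b c)

theorem continuous_arcCurvature
    (hint : ∀ a b, IntervalIntegrable (periodize L (curvature γ L)) volume a b) :
    Continuous fun p : ℝ × ℝ => arcCurvature γ L p.1 p.2 := by
  have h : Continuous fun x => arcCurvature γ L 0 x := intervalIntegral.continuous_primitive hint 0
  have : (fun p : ℝ × ℝ => arcCurvature γ L p.1 p.2) =
      fun p => arcCurvature γ L 0 p.2 - arcCurvature γ L 0 p.1 := by
    ext p
    rw [← arcCurvature_add hint 0 p.1 p.2]
    ring
  rw [this]
  fun_prop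

theorem arcCurvature_nonneg {x y : ℝ} (hxy : x ≤ y)
    (h : ∀ s ∈ Ioo x y, 0 ≤ periodize L (curvature γ L) s) : 0 ≤ arcCurvature γ L x y := by
  rw [arcCurvature, intervalIntegral.integral_of_le hxy, integral_Ioc_eq_integral_Ioo]
  exact setIntegral_nonneg measurableSet_Ioo h

theorem arcCurvature_nonpos {x y : ℝ} (hxy : x ≤ y)
    (h : ∀ s ∈ Ioo x y, periodize L (curvature γ L) s ≤ 0) : arcCurvature γ L x y ≤ 0 := by
  rw [arcCurvature, intervalIntegral.integral_of_le hxy, integral_Ioc_eq_integral_Ioo]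
  exact setIntegral_nonpos measurableSet_Ioo h

/-- That `Q` holds inside an arc is a closed condition on its endpoints: each parameter where `Q`
fails must stay outside the open interval. So the total curvature is maximized in absolute value
over a compact set of arcs. -/
theorem exists_maximal_arc {A : ℝ → ℝ → Prop} (hA : IsArcFamily A)
    (hint : ∀ a b, IntervalIntegrable (periodize L (curvature γ L)) volume a b) (Q : ℝ → Prop)
    {x y : ℝ} (hlt : x < y) (hxy : A x y) (hQ : ∀ s ∈ Ioo x y, Q s) :
    ∃ c d, c ≤ x ∧ y ≤ d ∧ A c d ∧ (∀ s ∈ Ioo c d, Q s) ∧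
      ∀ c' d', c' ≤ c → d ≤ d' → A c' d' → (∀ s ∈ Ioo c' d', Q s) →
        |arcCurvature γ L c' d'| ≤ |arcCurvature γ L c d| := by
  have hclosed : IsClosed {p : ℝ × ℝ | ∀ s ∈ Ioo p.1 p.2, Q s} := by
    have : {p : ℝ × ℝ | ∀ s ∈ Ioo p.1 p.2, Q s} =
        ⋂ s ∈ {s | ¬ Q s}, {p : ℝ × ℝ | s ≤ p.1 ∨ p.2 ≤ s} := by
      ext p
      simp only [mem_ofPred_eq, mem_iInter, mem_Ioo]
      refine forall_congr' fun s => ?_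
      rw [← not_lt, ← not_lt, ← not_and_or]
      tauto
    rw [this]
    refine isClosed_biInter fun s _ => ?_
    exact (isClosed_le continuous_const continuous_fst).union
      (isClosed_le continuous_snd continuous_const)
  obtain ⟨⟨c, d⟩, ⟨⟨h1, h2, h3⟩, h4⟩, hmax⟩ :=
    ((hA.isCompact x y hlt).inter_right hclosed).exists_isMaxOn ⟨(x, y), ⟨le_rfl, le_rfl, hxy⟩, hQ⟩
      (continuous_arcCurvature hint).abs.continuousOn
  exact ⟨c, d, h1, h2, h3, h4, fun c' d' hc hd hA' hQ' =>
    hmax (show (c', d') ∈ _ from ⟨⟨hc.trans h1, h2.trans hd, hA'⟩, hQ'⟩)⟩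

/-- If the maximal convex arcs turn by more than `π` and the maximal concave arcs turn by more
than `-π`, then so does every arc. -/
theorem neg_pi_lt_arcCurvature {A : ℝ → ℝ → Prop} (hA : IsArcFamily A)
    (hint : ∀ a b, IntervalIntegrable (periodize L (curvature γ L)) volume a b)
    (hright : ∀ z, 0 < periodize L (curvature γ L) z →
      ∃ δ > 0, ∀ s ∈ Ioo z (z + δ), 0 < periodize L (curvature γ L) s)
    {a b : ℝ} (hlt : a < b) (hab : A a b)
    (hconv : ∀ c d, a < c → d < b → IsMaximalConvexArc A γ L c d → Real.pi < arcCurvature γ L c d)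
    (hconc : ∀ c d, IsMaximalConcaveArc A γ L c d → -Real.pi < arcCurvature γ L c d) :
    -Real.pi < arcCurvature γ L a b := by
  by_contra! hle
  have hpi := Real.pi_pos
  have hadd := arcCurvature_add hint
  -- Compactness provides a shortest subarc `[x, y]` with total curvature at most -π.
  have hcomp : IsCompact {p : ℝ × ℝ | (p ∈ Icc a b ×ˢ Icc a b) ∧ p.1 ≤ p.2 ∧
      arcCurvature γ L p.1 p.2 ≤ -Real.pi} :=
    (isCompact_Icc.prod isCompact_Icc).inter_right ((isClosed_le continuous_fst continuous_snd).inter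
      (isClosed_le (continuous_arcCurvature hint) continuous_const))
  obtain ⟨⟨x, y⟩, ⟨⟨hx, hy⟩, hxy, hdrop⟩, hmin⟩ := hcomp.exists_isMinOn
    ⟨(a, b), ⟨⟨le_rfl, hlt.le⟩, hlt.le, le_rfl⟩, hlt.le, hle⟩
    (f := fun p : ℝ × ℝ => p.2 - p.1) (by fun_prop)
  simp only at hx hy hxy hdrop
  have hshort : ∀ x' y', x ≤ x' → x' ≤ y' → y' ≤ y → y' - x' < y - x →
      -Real.pi < arcCurvature γ L x' y' := by
    intro x' y' h1 h2 h3 h4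
    by_contra! h
    have := hmin (show (x', y') ∈ _ from
      ⟨⟨⟨hx.1.trans h1, h2.trans (h3.trans hy.2)⟩, hx.1.trans (h1.trans h2), h3.trans hy.2⟩, h2, h⟩)
    simp only [mem_ofPred_eq] at this
    linarith
  have hxy' : x < y := by
    refine lt_of_le_of_ne hxy ?_
    rintro rfl
    rw [arcCurvature, intervalIntegral.integral_same] at hdrop
    linarith
  have hAxy : A x y := hA.sub hab hx.1 hxy' hy.2
  -- If `[x, y]` is concave, passing to a maximal concave arc only lowers the total curvature,
  -- against `hconc`.
  by_cases hK : ∀ s ∈ Ioo x y, periodize L (curvature γ L) s ≤ 0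
  · obtain ⟨c, d, hc, hd, hAcd, hQ, hmax⟩ := exists_maximal_arc hA hint _ hxy' hAxy hK
    have hne : ∃ s ∈ Ioo c d, periodize L (curvature γ L) s ≠ 0 := by
      by_contra! h0
      have := arcCurvature_nonneg hxy (fun s hs => (h0 s ⟨hc.trans_lt hs.1, hs.2.trans_le hd⟩).ge)
      linarith
    have h1 := hconc c d ⟨⟨hAcd, hQ, hne⟩, by
      rintro ⟨c', d', hc', hd', ⟨hA', hQ', -⟩, hlt'⟩
      exact (hmax c' d' hc' hd' hA' hQ').not_gt hlt'⟩
    have h2 := arcCurvature_nonpos hc (fun s hs => hQ s ⟨hs.1, hs.2.trans (hxy'.trans_le hd)⟩)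
    have h3 := arcCurvature_nonpos hd (fun s hs => hQ s ⟨(hc.trans_lt hxy').trans hs.1, hs.2⟩)
    linarith [hadd c x y, hadd c y d]
  · push Not at hK
    obtain ⟨z, hz, hKz⟩ := hK
    obtain ⟨δ, hδ, hpos⟩ := hright z hKz
    obtain ⟨w, hzw, hw⟩ : ∃ w, z < w ∧ w ≤ min (z + δ) y :=
      ⟨min (z + δ) y, lt_min (by linarith) hz.2, le_rfl⟩
    have hw1 := hw.trans (min_le_left _ _)
    have hw2 := hw.trans (min_le_right _ _)
    have hposw : ∀ s ∈ Ioo z w, 0 < periodize L (curvature γ L) s := fun s hs =>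
      hpos s ⟨hs.1, hs.2.trans_le hw1⟩
    obtain ⟨c, d, hc, hd, hAcd, hQ, hmax⟩ := exists_maximal_arc hA hint _ hzw
      (hA.sub hAxy hz.1.le hzw hw2) (fun s hs => (hposw s hs).le)
    have hcd : z < d := hzw.trans_le hd
    -- Otherwise `[x, z]` has nonnegative curvature, and dropping it leaves a shorter arc that still
    -- violates the bound. The right end is symmetric.
    have hxc : x < c := by
      by_contra! h
      have h1 := arcCurvature_nonneg hz.1.le (fun s hs => hQ s ⟨h.trans_lt hs.1, hs.2.trans hcd⟩)
      have h2 := hshort z y hz.1.le hz.2.le le_rfl (by linarith [hz.1])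
      linarith [hadd x z y]
    have hdy : d < y := by
      by_contra! h
      have h1 := arcCurvature_nonneg hz.2.le
        (fun s hs => hQ s ⟨hc.trans_lt hs.1, hs.2.trans_le h⟩)
      have h2 := hshort x z le_rfl hz.1.le hz.2.le (by linarith [hz.2])
      linarith [hadd x z y]
    obtain ⟨s, hs⟩ := exists_between hzw
    have h1 := hconv c d (hx.1.trans_lt hxc) (hdy.trans_le hy.2) ⟨⟨hAcd, hQ, s,
      ⟨hc.trans_lt hs.1, hs.2.trans_le hd⟩, (hposw s hs).ne'⟩, by
      rintro ⟨c', d', hc', hd', ⟨hA', hQ', -⟩, hlt'⟩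
      exact (hmax c' d' hc' hd' hA' hQ').not_gt hlt'⟩
    have h2 := hshort x c le_rfl hxc.le (hc.trans hz.2.le) (by linarith [hz.2])
    have h3 := hshort d y (hxc.le.trans (hc.trans hcd.le)) hdy.le le_rfl (by linarith)
    linarith [hadd x c d, hadd x d y]

end

/-! ### Complex coordinates and periodization -/

/-- The identification of the Euclidean plane with `ℂ`. -/
def toComplex : Plane ≃ₗᵢ[ℝ] ℂ := Complex.orthonormalBasisOneI.repr.symm

theorem toComplex_re (v : Plane) : (toComplex v).re = v 0 := by
  simp [toComplex, ← OrthonormalBasis.sum_repr_symm, Fin.sum_univ_two]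

theorem toComplex_im (v : Plane) : (toComplex v).im = v 1 := by
  simp [toComplex, ← OrthonormalBasis.sum_repr_symm, Fin.sum_univ_two]

theorem toComplex_rot90 (v : Plane) : toComplex (rot90 v) = Complex.I * toComplex v := by
  apply Complex.ext <;> simp [toComplex_re, toComplex_im, rot90]

theorem inner_eq_coords (v w : Plane) : inner ℝ v w = v 0 * w 0 + v 1 * w 1 := by
  simp [PiLp.inner_apply, Fin.sum_univ_two, mul_comm]

theorem norm_sq_eq_coords (v : Plane) : ‖v‖ ^ 2 = v 0 ^ 2 + v 1 ^ 2 := by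
  rw [← real_inner_self_eq_norm_sq, inner_eq_coords]; ring

/-- For a unit vector `t`, division by `t` gives the coordinates in the frame `t`, `rot90 t`. -/
theorem toComplex_div_re {v t : Plane} (ht : ‖t‖ = 1) :
    (toComplex v / toComplex t).re = inner ℝ v t := by
  have h : t 0 * t 0 + t 1 * t 1 = 1 := by
    have := norm_sq_eq_coords t; rw [ht] at this; linarith
  rw [Complex.div_re, Complex.normSq_apply, inner_eq_coords]
  simp only [toComplex_re, toComplex_im, h, div_one]

theorem toComplex_div_im {v t : Plane} (ht : ‖t‖ = 1) :
    (toComplex v / toComplex t).im = inner ℝ v (rot90 t) := by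
  have h : t 0 * t 0 + t 1 * t 1 = 1 := by
    have := norm_sq_eq_coords t; rw [ht] at this; linarith
  rw [Complex.div_im, Complex.normSq_apply, inner_eq_coords]
  simp only [toComplex_re, toComplex_im, h, div_one, rot90]
  simp
  ring

section Periodize
variable {α : Type*} {L : ℝ} (hL : 0 < L) (f : ℝ → α)
include hL

theorem periodize_of_mem_Ico {s : ℝ} (hs : s ∈ Ico 0 L) : periodize L f s = f s := by
  have h : Int.fract (s / L) = s / L :=
    Int.fract_eq_self.2 ⟨div_nonneg hs.1 hL.le, (div_lt_one hL).2 hs.2⟩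
  rw [periodize, h, mul_div_cancel₀ _ hL.ne']

theorem periodic_periodize : Function.Periodic (periodize L f) L := fun s => by
  have : (s + L) / L = s / L + 1 := by field_simp
  rw [periodize, periodize, this, Int.fract_add_one]

theorem exists_periodize_eq (s : ℝ) : ∃ n : ℤ, s - n * L ∈ Ico 0 L ∧
    ∀ g : ℝ → α, ∀ x, x - n * L ∈ Ico 0 L → periodize L g x = g (x - n * L) := by
  refine ⟨⌊s / L⌋, ⟨?_, ?_⟩, fun g x hx => ?_⟩
  · have := Int.floor_le (s / L)
    rw [le_div_iff₀ hL] at this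
    linarith
  · have := Int.lt_floor_add_one (s / L)
    rw [div_lt_iff₀ hL] at this
    linarith
  · rw [← periodize_of_mem_Ico hL g hx, (periodic_periodize hL g).sub_int_mul_eq]

end Periodize

theorem rot90_zero_coord (v : Plane) : rot90 v 0 = -(v 1) := by simp [rot90]
theorem rot90_one_coord (v : Plane) : rot90 v 1 = v 0 := by simp [rot90]

theorem continuous_rot90 : Continuous rot90 := by
  have : rot90 = fun v => toComplex.symm (Complex.I * toComplex v) := by
    ext1 v
    rw [← toComplex_rot90, LinearIsometryEquiv.symm_apply_apply]
  rw [this]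
  fun_prop

/-- A vector orthogonal to a unit vector `t` is a multiple of `rot90 t`. -/
theorem eq_smul_rot90_of_inner_eq_zero {t d : Plane} (ht : ‖t‖ = 1) (h : inner ℝ d t = 0) :
    d = (inner ℝ d (rot90 t) : ℝ) • rot90 t := by
  have h1 := norm_sq_eq_coords t
  rw [ht] at h1
  rw [inner_eq_coords] at h ⊢
  ext i
  fin_cases i
  · simp [rot90_zero_coord, rot90_one_coord]
    linear_combination d 0 * h1 + t 0 * h
  · simp [rot90_zero_coord, rot90_one_coord]
    linear_combination d 1 * h1 + t 1 * h

/-! ### Curvature and tangent angle -/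

namespace IsAdmissible
variable {γ : ℝ → Plane} {L : ℝ} (h : IsAdmissible γ L)
include h

theorem hasDerivWithinAt {s : ℝ} (hs : s ∈ Icc 0 L) :
    HasDerivWithinAt γ (tangent γ L s) (Icc 0 L) s :=
  (h.c1.differentiableOn one_ne_zero s hs).hasDerivWithinAt

theorem continuousOn_tangent : ContinuousOn (tangent γ L) (Icc 0 L) :=
  h.c1.continuousOn_derivWithin (uniqueDiffOn_Icc h.length_pos) le_rfl

/-- On a piece where the curve is `C²` the curvature agrees with a continuous function, except
possibly at the endpoints, where it may vanish instead. -/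
theorem exists_curvature_on_piece {u v : ℝ} (huv : u < v) (hsub : Icc u v ⊆ Icc 0 L)
    (h2 : ContDiffOn ℝ 2 γ (Icc u v)) :
    ∃ κ : ℝ → ℝ, ContinuousOn κ (Icc u v) ∧
      (∀ s ∈ Ioo u v, curvature γ L s = κ s ∧
        HasDerivAt (tangent γ L) (κ s • normal γ L s) s) ∧
      ∀ s ∈ Icc u v, curvature γ L s ≠ 0 → curvature γ L s = κ s := by
  have hud := uniqueDiffOn_Icc huv
  have htan : ContDiffOn ℝ 1 (tangent γ L) (Icc u v) := by
    refine (h2.derivWithin hud (m := 1) (by norm_num)).congr fun s hs => ?_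
    exact ((h.hasDerivWithinAt (hsub hs)).mono hsub).derivWithin (hud s hs) |>.symm
  have hdiff : DifferentiableOn ℝ (tangent γ L) (Icc u v) := htan.differentiableOn one_ne_zero
  refine ⟨fun s => inner ℝ (derivWithin (tangent γ L) (Icc u v) s) (normal γ L s),
    (htan.continuousOn_derivWithin hud le_rfl).inner
      (continuous_rot90.comp_continuousOn htan.continuousOn), fun s hs => ?_, fun s hs hne => ?_⟩
  · have hn : Icc u v ∈ 𝓝 s := Icc_mem_nhds hs.1 hs.2
    have hn' : Icc 0 L ∈ 𝓝 s := mem_of_superset hn hsub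
    have hd := (hdiff s (Ioo_subset_Icc_self hs)).differentiableAt hn
    simp only [curvature, derivWithin_of_mem_nhds hn, derivWithin_of_mem_nhds hn', true_and]
    have horth : inner ℝ (deriv (tangent γ L) s) (tangent γ L s) = 0 := by
      have h1 := hd.hasDerivAt.inner ℝ hd.hasDerivAt
      have h3 : HasDerivAt (fun s => inner ℝ (tangent γ L s) (tangent γ L s)) 0 s := by
        refine (hasDerivAt_const s (1 : ℝ)).congr_of_eventuallyEq ?_
        filter_upwards [hn'] with x hx
        rw [real_inner_self_eq_norm_sq, h.arclength x hx, one_pow]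
      have := h1.unique h3
      rw [real_inner_comm] at this
      linarith
    rw [normal, ← eq_smul_rot90_of_inner_eq_zero (h.arclength s (mem_of_mem_nhds hn')) horth]
    exact hd.hasDerivAt
  -- Where the tangent is not differentiable, `derivWithin` is 0 and so is the curvature. A nonzero
  -- value thus forces differentiability, and the derivative within the piece agrees.
  · have hd : DifferentiableWithinAt ℝ (tangent γ L) (Icc 0 L) s := by
      by_contra hd
      rw [curvature, derivWithin_zero_of_not_differentiableWithinAt hd, inner_zero_left] at hne
      exact hne rfl
    simp only [curvature, derivWithin_subset hsub (hud s hs) hd]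

theorem exists_pieces : ∃ (n : ℕ) (t : ℕ → ℝ), t 0 = 0 ∧ t n = L ∧
    (∀ i < n, t i < t (i + 1)) ∧ (∀ i < n, Icc (t i) (t (i + 1)) ⊆ Icc 0 L) ∧
    (∀ i < n, ContDiffOn ℝ 2 γ (Icc (t i) (t (i + 1)))) ∧
    ∀ s ∈ Ico 0 L, ∃ i < n, s ∈ Ico (t i) (t (i + 1)) := by
  obtain ⟨n, t, h0, hn, hlt, h2⟩ := h.piecewise_c2
  have hmono : ∀ i j, i ≤ j → j ≤ n → t i ≤ t j := by
    intro i j hij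
    induction j, hij using Nat.le_induction with
    | base => intro _; exact le_rfl
    | succ j hj ih => intro hjn; exact (ih (by omega)).trans (hlt j (by omega)).le
  refine ⟨n, t, h0, hn, hlt, fun i hi => Icc_subset_Icc ?_ ?_, h2, fun s hs => ?_⟩
  · rw [← h0]; exact hmono 0 i (by omega) (by omega)
  · rw [← hn]; exact hmono (i + 1) n (by omega) le_rfl
  · have : ∀ m ≤ n, s < t m → ∃ i < m, s ∈ Ico (t i) (t (i + 1)) := by
      intro m
      induction m with
      | zero => intro _ hm; rw [h0] at hm; exact absurd hs.1 hm.not_ge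
      | succ m ih =>
        intro hm hsm
        by_cases hc : s < t m
        · obtain ⟨i, hi, h⟩ := ih (by omega) hc
          exact ⟨i, by omega, h⟩
        · exact ⟨m, by omega, not_lt.1 hc, hsm⟩
    exact this n le_rfl (hn ▸ hs.2)

theorem intervalIntegrable_curvature : IntervalIntegrable (curvature γ L) volume 0 L := by
  obtain ⟨n, t, h0, hn, hlt, hsub, h2, -⟩ := h.exists_pieces
  suffices IntervalIntegrable (curvature γ L) volume (t 0) (t n) by rwa [h0, hn] at this
  refine IntervalIntegrable.trans_iterate fun i hi => ?_
  obtain ⟨κ, hκ, heq, -⟩ := h.exists_curvature_on_piece (hlt i hi) (hsub i hi) (h2 i hi)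
  refine (hκ.intervalIntegrable_of_Icc (hlt i hi).le).congr_ae ?_
  rw [uIoc_of_le (hlt i hi).le, ← restrict_Ioo_eq_restrict_Ioc]
  filter_upwards [ae_restrict_mem measurableSet_Ioo] with s hs
  exact (heq s hs).1.symm

/-- The Frenet equation holds, with continuous curvature, off a countable set. -/
theorem exists_countable_frenet : ∃ E : Set ℝ, E.Countable ∧ ∀ s ∈ Ioo 0 L \ E,
    ContinuousAt (curvature γ L) s ∧
      HasDerivAt (tangent γ L) (curvature γ L s • normal γ L s) s := by
  obtain ⟨n, t, h0, hn, hlt, hsub, h2, hex⟩ := h.exists_pieces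
  refine ⟨range t, countable_range t, ?_⟩
  rintro s ⟨hs, hst⟩
  obtain ⟨i, hi, hsi⟩ := hex s ⟨hs.1.le, hs.2⟩
  have hsi' : s ∈ Ioo (t i) (t (i + 1)) :=
    ⟨lt_of_le_of_ne hsi.1 fun he => hst ⟨i, he⟩, hsi.2⟩
  obtain ⟨κ, hκ, heq, -⟩ := h.exists_curvature_on_piece (hlt i hi) (hsub i hi) (h2 i hi)
  refine ⟨?_, (heq s hsi').1 ▸ (heq s hsi').2⟩
  refine (hκ.continuousAt (Icc_mem_nhds hsi'.1 hsi'.2)).congr ?_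
  filter_upwards [Ioo_mem_nhds hsi'.1 hsi'.2] with x hx
  exact (heq x hx).1.symm

/-- Each `z` lies in a half-open piece `[t i, t (i + 1))`. A nonzero curvature there equals the
continuous `κ` of that piece, so positivity persists to the right. -/
theorem curvature_pos_right {z : ℝ} (hz : z ∈ Ico 0 L) (hpos : 0 < curvature γ L z) :
    ∃ δ > 0, z + δ ≤ L ∧ ∀ s ∈ Ioo z (z + δ), 0 < curvature γ L s := by
  obtain ⟨n, t, h0, hn, hlt, hsub, h2, hex⟩ := h.exists_pieces
  obtain ⟨i, hi, hzi⟩ := hex z hz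
  obtain ⟨κ, hκ, heq, hne⟩ := h.exists_curvature_on_piece (hlt i hi) (hsub i hi) (h2 i hi)
  have hzI : z ∈ Icc (t i) (t (i + 1)) := Ico_subset_Icc_self hzi
  rw [hne z hzI hpos.ne'] at hpos
  have hev := (hκ z hzI).eventually (lt_mem_nhds hpos)
  obtain ⟨δ, hδ, hball⟩ := Metric.mem_nhdsWithin_iff.1 hev
  have hr := (hsub i hi (right_mem_Icc.2 (hlt i hi).le)).2
  refine ⟨min δ (t (i + 1) - z), lt_min hδ (sub_pos.2 hzi.2), ?_, fun s hs => ?_⟩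
  · linarith [min_le_right δ (t (i + 1) - z)]
  · have h1 := min_le_left δ (t (i + 1) - z)
    have h3 := min_le_right δ (t (i + 1) - z)
    have hs' : s ∈ Ioo (t i) (t (i + 1)) :=
      ⟨hzi.1.trans_lt hs.1, by linarith [hs.2]⟩
    rw [(heq s hs').1]
    refine hball ⟨?_, Ioo_subset_Icc_self hs'⟩
    rw [Metric.mem_ball, Real.dist_eq, abs_lt]
    constructor <;> linarith [hs.1, hs.2]

theorem intervalIntegrable_periodize (a b : ℝ) :
    IntervalIntegrable (periodize L (curvature γ L)) volume a b := by
  refine (periodic_periodize h.length_pos _).intervalIntegrable₀ h.length_pos.ne' ?_ a b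
  refine h.intervalIntegrable_curvature.congr_ae ?_
  rw [uIoc_of_le h.length_pos.le, ← restrict_Ioo_eq_restrict_Ioc]
  filter_upwards [ae_restrict_mem measurableSet_Ioo] with s hs
  exact (periodize_of_mem_Ico h.length_pos _ (Ioo_subset_Ico_self hs)).symm

theorem periodize_curvature_pos_right (z : ℝ) (hz : 0 < periodize L (curvature γ L) z) :
    ∃ δ > 0, ∀ s ∈ Ioo z (z + δ), 0 < periodize L (curvature γ L) s := by
  obtain ⟨n, hn, heq⟩ := exists_periodize_eq (α := ℝ) h.length_pos z
  rw [heq _ z hn] at hz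
  obtain ⟨δ, hδ, hle, hpos⟩ := h.curvature_pos_right hn hz
  refine ⟨δ, hδ, fun s hs => ?_⟩
  rw [heq _ s ⟨by linarith [hn.1, hs.1], by linarith [hs.2]⟩]
  exact hpos _ ⟨by linarith [hs.1], by linarith [hs.2]⟩

theorem arcCurvature_eq_integral {s : ℝ} (hs : s ∈ Icc 0 L) :
    arcCurvature γ L 0 s = ∫ x in (0)..s, curvature γ L x := by
  refine intervalIntegral.integral_congr_ae ?_
  rw [← ae_restrict_iff' measurableSet_uIoc, uIoc_of_le hs.1, ← restrict_Ioo_eq_restrict_Ioc]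
  filter_upwards [ae_restrict_mem measurableSet_Ioo] with x hx
  exact periodize_of_mem_Ico h.length_pos _ ⟨hx.1.le, hx.2.trans_le hs.2⟩

/-- The tangent vector turns by the total curvature. -/
theorem toComplex_tangent {s : ℝ} (hs : s ∈ Icc 0 L) :
    toComplex (tangent γ L s) = toComplex (tangent γ L 0) *
      Complex.exp ((arcCurvature γ L 0 s : ℂ) * Complex.I) := by
  rw [h.arcCurvature_eq_integral hs]
  set F : ℝ → ℝ := fun s => ∫ x in (0)..s, curvature γ L x with hF
  have hint := h.intervalIntegrable_curvature
  have hsub : Icc 0 s ⊆ Icc 0 L := Icc_subset_Icc_right hs.2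
  have hFc : ContinuousOn F (Icc 0 s) := by
    have := intervalIntegral.continuousOn_primitive_interval (f := curvature γ L) (a := 0) (b := L)
      (μ := volume) (by rw [uIcc_of_le h.length_pos.le, integrableOn_Icc_iff_integrableOn_Ioc]
                        exact (intervalIntegrable_iff_integrableOn_Ioc_of_le h.length_pos.le).1 hint)
    rw [uIcc_of_le h.length_pos.le] at this
    exact this.mono hsub
  obtain ⟨E, hE, hfr⟩ := h.exists_countable_frenet
  -- The tangent times `exp (-F * I)` is continuous with derivative 0 off a countable set, hence
  -- constant; the break points do no harm.
  have key := integral_eq_of_hasDerivAt_off_countable_of_le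
    (fun s => toComplex (tangent γ L s) * Complex.exp (-((F s : ℂ) * Complex.I)))
    (fun _ => 0) hs.1 hE ?_ ?_ intervalIntegrable_const
  · rw [intervalIntegral.integral_zero] at key
    have h0 : F 0 = 0 := intervalIntegral.integral_same
    rw [h0, eq_comm, sub_eq_zero] at key
    simp only [Complex.ofReal_zero, zero_mul, neg_zero, Complex.exp_zero, mul_one] at key
    rw [← key, mul_assoc, ← Complex.exp_add, neg_add_cancel, Complex.exp_zero, mul_one]
  · have := (toComplex.continuous.comp_continuousOn (h.continuousOn_tangent.mono hsub))
    refine this.mul ?_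
    fun_prop
  · rintro x ⟨hx, hxE⟩
    have hx' : x ∈ Ioo 0 L := ⟨hx.1, hx.2.trans_le hs.2⟩
    obtain ⟨hc, hd⟩ := hfr x ⟨hx', hxE⟩
    have hFd : HasDerivAt F (curvature γ L x) x := by
      refine intervalIntegral.integral_hasDerivAt_right
        (hint.mono_set ?_) ?_ hc
      · rw [uIcc_of_le hx'.1.le, uIcc_of_le h.length_pos.le]
        exact Icc_subset_Icc_right hx'.2.le
      · refine ⟨Ioc 0 L, Ioc_mem_nhds hx'.1 hx'.2, ?_⟩
        exact hint.aestronglyMeasurable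
    have h1 : HasDerivAt (fun s => toComplex (tangent γ L s))
        (toComplex (curvature γ L x • normal γ L x)) x :=
      toComplex.toContinuousLinearEquiv.toContinuousLinearMap.hasFDerivAt.comp_hasDerivAt x hd
    have h2 := ((hFd.ofReal_comp.mul_const Complex.I).neg).cexp
    refine (h1.mul h2).congr_deriv ?_
    rw [map_smul, normal, toComplex_rot90, Complex.real_smul]
    ring

end IsAdmissible

/-! ### The two branches at an external cusp -/

theorem monotoneOn_Icc_of_hasDerivWithinAt_nonneg {f f' : ℝ → ℝ} {u v : ℝ}
    (hf : ∀ s ∈ Icc u v, HasDerivWithinAt f (f' s) (Icc u v) s)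
    (hf' : ∀ s ∈ Icc u v, 0 ≤ f' s) : MonotoneOn f (Icc u v) :=
  monotoneOn_of_hasDerivWithinAt_nonneg (convex_Icc u v)
    (fun s hs => (hf s hs).continuousWithinAt)
    (fun s hs => (hf s (interior_subset hs)).mono interior_subset)
    (fun s hs => hf' s (interior_subset hs))

/-- A curve that starts in `0` with velocity close to `1`. -/
structure IsBranch (β β' : ℝ → ℂ) (ε : ℝ) : Prop where
  pos : 0 < ε
  zero : β 0 = 0
  deriv : ∀ s ∈ Icc 0 ε, HasDerivWithinAt β (β' s) (Icc 0 ε) s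
  re_ge : ∀ s ∈ Icc 0 ε, 1 / 2 ≤ (β' s).re
  im_le : ∀ s ∈ Icc 0 ε, |(β' s).im| ≤ 1 / 4

namespace IsBranch
variable {β β' : ℝ → ℂ} {ε : ℝ} (h : IsBranch β β' ε)
include h

theorem hasDerivWithinAt_re {s : ℝ} (hs : s ∈ Icc 0 ε) :
    HasDerivWithinAt (fun s => (β s).re) (β' s).re (Icc 0 ε) s :=
  Complex.reCLM.hasFDerivAt.comp_hasDerivWithinAt s (h.deriv s hs)

theorem hasDerivWithinAt_im {s : ℝ} (hs : s ∈ Icc 0 ε) :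
    HasDerivWithinAt (fun s => (β s).im) (β' s).im (Icc 0 ε) s :=
  Complex.imCLM.hasFDerivAt.comp_hasDerivWithinAt s (h.deriv s hs)

theorem half_sub_le {s t : ℝ} (hs : s ∈ Icc 0 ε) (ht : t ∈ Icc 0 ε) (hst : s ≤ t) :
    (t - s) / 2 ≤ (β t).re - (β s).re := by
  have := monotoneOn_Icc_of_hasDerivWithinAt_nonneg (f := fun s => (β s).re - s * (1 / 2))
    (fun s hs => (h.hasDerivWithinAt_re hs).sub ((hasDerivWithinAt_id s _).mul_const (1 / 2)))
    (fun s hs => by linarith [h.re_ge s hs]) hs ht hst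
  simp only at this
  linarith

/-- The slope is at most (1/4)/(1/2) = 1/2; accordingly `re / 2 - im` and `re / 2 + im` are both
monotone. -/
theorem abs_im_sub_le {s t : ℝ} (hs : s ∈ Icc 0 ε) (ht : t ∈ Icc 0 ε) :
    |(β t).im - (β s).im| ≤ |(β t).re - (β s).re| / 2 := by
  wlog hst : s ≤ t generalizing s t
  · rw [abs_sub_comm, abs_sub_comm (β t).re]
    exact this ht hs (le_of_not_ge hst)
  have h1 := monotoneOn_Icc_of_hasDerivWithinAt_nonneg (f := fun s => (β s).re * (1 / 2) - (β s).im)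
    (fun s hs => ((h.hasDerivWithinAt_re hs).mul_const (1 / 2)).sub (h.hasDerivWithinAt_im hs))
    (fun s hs => by linarith [h.re_ge s hs, (abs_le.1 (h.im_le s hs)).2]) hs ht hst
  have h2 := monotoneOn_Icc_of_hasDerivWithinAt_nonneg (f := fun s => (β s).re * (1 / 2) + (β s).im)
    (fun s hs => ((h.hasDerivWithinAt_re hs).mul_const (1 / 2)).add (h.hasDerivWithinAt_im hs))
    (fun s hs => by linarith [h.re_ge s hs, (abs_le.1 (h.im_le s hs)).1]) hs ht hst
  have h3 := h.half_sub_le hs ht hst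
  simp only at h1 h2
  rw [abs_of_nonneg (a := (β t).re - (β s).re) (by linarith), abs_le]
  constructor <;> linarith

theorem re_injOn {s t : ℝ} (hs : s ∈ Icc 0 ε) (ht : t ∈ Icc 0 ε) (hst : (β s).re = (β t).re) :
    s = t := by
  rcases le_total s t with hle | hle
  · linarith [h.half_sub_le hs ht hle]
  · linarith [h.half_sub_le ht hs hle]

theorem re_nonneg {s : ℝ} (hs : s ∈ Icc 0 ε) : 0 ≤ (β s).re := by
  have := h.half_sub_le (left_mem_Icc.2 h.pos.le) hs hs.1
  rw [h.zero, Complex.zero_re] at this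
  linarith [hs.1]

/-- Such a curve is the graph of a Lipschitz function over the tangent. -/
theorem exists_graph : ∃ f : ℝ → ℝ, f 0 = 0 ∧
    (∀ x ∈ Icc 0 (ε / 2), ∀ y ∈ Icc 0 (ε / 2), |f x - f y| ≤ |x - y| / 2) ∧
    (∀ x ∈ Icc 0 (ε / 2), ∃ s ∈ Icc 0 ε, β s = ⟨x, f x⟩) ∧
    ∀ s ∈ Icc 0 ε, (β s).re ≤ ε / 2 → (β s).im = f (β s).re := by
  have hε := h.pos
  have hex : ∀ x ∈ Icc 0 (ε / 2), ∃ s ∈ Icc 0 ε, (β s).re = x := by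
    intro x hx
    have hc : ContinuousOn (fun s => (β s).re) (Icc 0 ε) := fun s hs =>
      (h.hasDerivWithinAt_re hs).continuousWithinAt
    have h1 := h.half_sub_le (left_mem_Icc.2 hε.le) (right_mem_Icc.2 hε.le) hε.le
    rw [h.zero, Complex.zero_re] at h1
    refine intermediate_value_Icc hε.le hc ⟨?_, ?_⟩
    · simpa [h.zero] using hx.1
    · linarith [hx.2]
  choose! τ hτ hre using hex
  have himm : ∀ s ∈ Icc 0 ε, (β s).re ≤ ε / 2 → (β s).im = (β (τ (β s).re)).im := by
    intro s hs hle
    have hm : (β s).re ∈ Icc 0 (ε / 2) := ⟨h.re_nonneg hs, hle⟩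
    rw [← h.re_injOn hs (hτ _ hm) (hre _ hm).symm]
  refine ⟨fun x => (β (τ x)).im, ?_, fun x hx y hy => ?_, fun x hx => ⟨τ x, hτ x hx, ?_⟩, himm⟩
  · have := himm 0 (left_mem_Icc.2 hε.le) (by rw [h.zero, Complex.zero_re]; positivity)
    rw [h.zero, Complex.zero_im, Complex.zero_re] at this
    exact this.symm
  · have := h.abs_im_sub_le (hτ y hy) (hτ x hx)
    rwa [hre x hx, hre y hy] at this
  · exact Complex.ext (hre x hx) rfl

end IsBranch

/-- If the set `K` is near `0` covered by two Lipschitz graphs over `[0, X]`, then a point below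
both graphs can be joined to the negative real axis outside `K`. -/
theorem exists_isPreconnected_below_graphs {K : Set ℂ} {δ X : ℝ} {f₁ f₂ : ℝ → ℝ}
    (hK : ∀ z ∈ K, ‖z‖ < δ → z.re ∈ Icc 0 X ∧ (z.im = f₁ z.re ∨ z.im = f₂ z.re))
    (hf₁ : ∀ x ∈ Icc 0 X, |f₁ x| ≤ x / 2) (hf₂ : ∀ x ∈ Icc 0 X, |f₂ x| ≤ x / 2)
    {w : ℂ} (hw : ‖w‖ < δ) (hw0 : 0 < w.re) (hwX : w.re ≤ X) (hwδ : 2 * w.re < δ)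
    (hw₁ : w.im < f₁ w.re) (hw₂ : w.im < f₂ w.re) {r : ℝ} (hr : 0 < r) (hrδ : r < δ) :
    ∃ P : Set ℂ, IsPreconnected P ∧ P ⊆ Kᶜ ∧ w ∈ P ∧ -(r : ℂ) ∈ P := by
  -- Near 0 the set `K` lies in the cone `|im| ≤ re / 2`. The path drops vertically from `w` to `B`,
  -- which is below the cone, and then runs straight to `-r` without meeting it.
  set B : ℂ := ⟨w.re, -w.re⟩ with hB
  have hBδ : ‖B‖ < δ := by
    refine (Complex.norm_le_abs_re_add_abs_im B).trans_lt ?_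
    simp only [hB, abs_neg, abs_of_pos hw0]
    linarith
  have hrn : ‖-(r : ℂ)‖ < δ := by
    rwa [norm_neg, Complex.norm_real, Real.norm_eq_abs, abs_of_pos hr]
  have hball := convex_ball (0 : ℂ) δ
  have hmem : ∀ z : ℂ, ‖z‖ < δ → z ∈ Metric.ball (0 : ℂ) δ := fun z hz => by simpa using hz
  refine ⟨segment ℝ w B ∪ segment ℝ B (-(r : ℂ)), ?_, ?_, Or.inl (left_mem_segment ℝ _ _),
    Or.inr (right_mem_segment ℝ _ _)⟩
  · exact IsPreconnected.union B (right_mem_segment ℝ _ _) (left_mem_segment ℝ _ _)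
      (convex_segment _ _).isPreconnected (convex_segment _ _).isPreconnected
  · rintro z (hz | hz) hzK
    · have hzδ : ‖z‖ < δ := by
        simpa using hball.segment_subset (hmem _ hw) (hmem _ hBδ) hz
      obtain ⟨p, q, hp, hq, hpq, rfl⟩ := hz
      obtain ⟨-, h⟩ := hK _ hzK hzδ
      have e1 : (p • w + q • B).re = w.re := by
        simp [hB]; linear_combination w.re * hpq
      have e2 : (p • w + q • B).im = p * w.im + q * (-w.re) := by simp [hB]
      rw [e1, e2] at h
      have b1 := abs_le.1 (hf₁ w.re ⟨hw0.le, hwX⟩)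
      have b2 := abs_le.1 (hf₂ w.re ⟨hw0.le, hwX⟩)
      obtain rfl : p = 1 - q := by linarith
      rcases h with h | h
      · rcases eq_or_lt_of_le hp with h0 | h0 <;> nlinarith
      · rcases eq_or_lt_of_le hp with h0 | h0 <;> nlinarith
    · have hzδ : ‖z‖ < δ := by
        simpa using hball.segment_subset (hmem _ hBδ) (hmem _ hrn) hz
      obtain ⟨p, q, hp, hq, hpq, rfl⟩ := hz
      obtain ⟨hre, h⟩ := hK _ hzK hzδ
      have hlow : -((p • B + q • (-(r : ℂ))).re / 2) ≤ (p • B + q • (-(r : ℂ))).im := by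
        rcases h with h | h
        · rw [h]; exact (abs_le.1 (hf₁ _ hre)).1
        · rw [h]; exact (abs_le.1 (hf₂ _ hre)).1
      simp [hB] at hlow
      obtain rfl : p = 1 - q := by linarith
      rcases eq_or_lt_of_le hq with h0 | h0 <;> nlinarith

/-- At an external cusp in `0` with outgoing tangent `1`, the outgoing branch lies to the right of
the incoming one. The predicate `E` stands for membership in the enclosed set. -/
theorem exists_cusp_order {Z W : ℝ → ℂ} {L : ℝ} (hL : 0 < L)
    (hZ : ∀ s ∈ Icc 0 L, HasDerivWithinAt Z (W s) (Icc 0 L) s) (hW : ContinuousOn W (Icc 0 L))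
    (hW0 : W 0 = 1) (hWL : W L = -1) (hZ0 : Z 0 = 0) (hZL : Z L = 0) (hinj : InjOn Z (Ico 0 L))
    {E : ℂ → Prop} (hpos : ∀ s ∈ Ioo 0 L, ∀ᶠ h : ℝ in 𝓝[>] 0, E (Z s + h * (Complex.I * W s)))
    (hext : ∀ᶠ h : ℝ in 𝓝[>] 0, ¬ E (-(h : ℂ)))
    (hE : ∀ P : Set ℂ, IsPreconnected P → P ⊆ (Z '' Icc 0 L)ᶜ → ∀ z ∈ P, ∀ w ∈ P, E w → E z) :
    ∃ η > 0, η < L / 2 ∧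
      (∀ s ∈ Icc (L - η) L, ∀ t ∈ Icc 0 η, (Z s).re = (Z t).re → (Z t).im ≤ (Z s).im) ∧
      (∀ s ∈ Icc 0 η, ∀ t ∈ Icc 0 η, s < t → (Z s).re < (Z t).re) ∧
      (∀ s ∈ Icc (L - η) L, ∀ t ∈ Icc (L - η) L, s < t → (Z t).re < (Z s).re) := by
  obtain ⟨δ₁, hδ₁, hd₁⟩ := Metric.continuousWithinAt_iff.1 (hW 0 (left_mem_Icc.2 hL.le)) (1 / 4)
    (by norm_num)
  obtain ⟨δ₂, hδ₂, hd₂⟩ := Metric.continuousWithinAt_iff.1 (hW L (right_mem_Icc.2 hL.le)) (1 / 4)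
    (by norm_num)
  obtain ⟨ε, hε, hεlt⟩ := exists_between (show (0 : ℝ) < min (min δ₁ δ₂) (L / 2) from
    lt_min (lt_min hδ₁ hδ₂) (half_pos hL))
  simp only [lt_min_iff] at hεlt
  obtain ⟨⟨hε1, hε2⟩, hεL⟩ := hεlt
  have hbd : ∀ z : ℂ, ‖z - 1‖ < 1 / 4 → 1 / 2 ≤ z.re ∧ |z.im| ≤ 1 / 4 := by
    intro z hz
    have h1 := abs_le.1 ((Complex.abs_re_le_norm (z - 1)).trans hz.le)
    have h2 := (Complex.abs_im_le_norm (z - 1)).trans hz.le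
    simp only [Complex.sub_re, Complex.one_re, Complex.sub_im, Complex.one_im, sub_zero] at h1 h2
    exact ⟨by linarith [h1.1], h2⟩
  have hB₂' : ∀ s ∈ Icc 0 ε, ‖W s - 1‖ < 1 / 4 := fun s hs => by
    have := hd₁ (x := s) ⟨hs.1, by linarith [hs.2]⟩
      (by rw [Real.dist_eq, abs_lt]; constructor <;> linarith [hs.1, hs.2])
    rwa [dist_eq_norm, hW0] at this
  have hB₁' : ∀ s ∈ Icc 0 ε, ‖-W (L - s) - 1‖ < 1 / 4 := fun s hs => by
    have := hd₂ (x := L - s) ⟨by linarith [hs.2], by linarith [hs.1]⟩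
      (by rw [Real.dist_eq, abs_lt]; constructor <;> linarith [hs.1, hs.2])
    rw [dist_eq_norm, hWL] at this
    rwa [← norm_neg, show -(-W (L - s) - 1) = W (L - s) - -1 by ring]
  have hb₂ : IsBranch Z W ε :=
    { pos := hε
      zero := hZ0
      deriv := fun s hs => (hZ s ⟨hs.1, by linarith [hs.2]⟩).mono
        (Icc_subset_Icc_right (by linarith))
      re_ge := fun s hs => (hbd _ (hB₂' s hs)).1
      im_le := fun s hs => (hbd _ (hB₂' s hs)).2 }
  -- The incoming branch is traversed backwards, so that it too leaves the cusp with velocity close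
  -- to 1.
  have hb₁ : IsBranch (fun s => Z (L - s)) (fun s => -W (L - s)) ε :=
    { pos := hε
      zero := by simp only [sub_zero]; exact hZL
      deriv := fun s hs => by
        have h1 := hZ (L - s) ⟨by linarith [hs.2], by linarith [hs.1]⟩
        have h2 : HasDerivWithinAt (fun s => L - s) (-1) (Icc 0 ε) s :=
          (hasDerivWithinAt_id s _).const_sub L
        have := h1.scomp s h2 (fun x hx => ⟨by linarith [hx.2], by linarith [hx.1]⟩)
        exact this.congr_deriv (by simp)
      re_ge := fun s hs => (hbd _ (hB₁' s hs)).1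
      im_le := fun s hs => (hbd _ (hB₁' s hs)).2 }
  obtain ⟨f₂, hf₂0, hlip₂, hon₂, hgr₂⟩ := hb₂.exists_graph
  obtain ⟨f₁, hf₁0, hlip₁, hon₁, hgr₁⟩ := hb₁.exists_graph
  have hX : 0 < ε / 2 := half_pos hε
  have hcone : ∀ f : ℝ → ℝ, f 0 = 0 →
      (∀ x ∈ Icc 0 (ε / 2), ∀ y ∈ Icc 0 (ε / 2), |f x - f y| ≤ |x - y| / 2) →
      ∀ x ∈ Icc 0 (ε / 2), |f x| ≤ x / 2 := by
    intro f h0 hlip x hx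
    have := hlip x hx 0 ⟨le_rfl, hX.le⟩
    rwa [h0, sub_zero, sub_zero, abs_of_nonneg hx.1] at this
  have hcont : ∀ f : ℝ → ℝ,
      (∀ x ∈ Icc 0 (ε / 2), ∀ y ∈ Icc 0 (ε / 2), |f x - f y| ≤ |x - y| / 2) →
      ContinuousOn f (Icc 0 (ε / 2)) := by
    intro f hlip
    refine (LipschitzOnWith.of_dist_le_mul (K := 1) fun x hx y hy => ?_).continuousOn
    rw [Real.dist_eq, Real.dist_eq, NNReal.coe_one, one_mul]
    exact (hlip x hx y hy).trans (half_le_self (abs_nonneg _))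
  have hZc : ContinuousOn Z (Icc 0 L) := fun s hs => (hZ s hs).continuousWithinAt
  -- the two branches meet only in the cusp
  have hne : ∀ x ∈ Ioc 0 (ε / 2), f₁ x ≠ f₂ x := by
    intro x hx heq
    obtain ⟨s, hs, hsx⟩ := hon₁ x (Ioc_subset_Icc_self hx)
    obtain ⟨t, ht, htx⟩ := hon₂ x (Ioc_subset_Icc_self hx)
    have hs0 : 0 < s := by
      refine lt_of_le_of_ne hs.1 ?_
      rintro rfl
      have := congrArg Complex.re hsx
      simp only [sub_zero, hZL, Complex.zero_re] at this
      exact hx.1.ne this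
    have : L - s = t := hinj ⟨by linarith [hs.2], by linarith⟩ ⟨ht.1, by linarith [ht.2]⟩
      (by rw [htx, ← heq]; exact hsx)
    linarith [hs.2, ht.2]
  -- near the cusp there are no other points of the curve
  obtain ⟨δ, hδ, hδX, hK⟩ : ∃ δ > 0, δ ≤ ε / 2 ∧ ∀ z ∈ Z '' Icc 0 L, ‖z‖ < δ →
      z.re ∈ Icc 0 (ε / 2) ∧ (z.im = f₁ z.re ∨ z.im = f₂ z.re) := by
    have hcomp : IsCompact (Z '' Icc ε (L - ε)) := isCompact_Icc.image_of_continuousOn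
      (hZc.mono (Icc_subset_Icc hε.le (by linarith)))
    have h0 : (0 : ℂ) ∈ (Z '' Icc ε (L - ε))ᶜ := by
      rintro ⟨s, hs, hs0⟩
      have := hinj ⟨hε.le.trans hs.1, by linarith [hs.2]⟩ ⟨le_rfl, hL⟩ (hs0.trans hZ0.symm)
      linarith [hs.1]
    obtain ⟨r, hr, hball⟩ := Metric.isOpen_iff.1 hcomp.isClosed.isOpen_compl 0 h0
    refine ⟨min r (ε / 2), lt_min hr hX, min_le_right _ _, ?_⟩
    rintro _ ⟨s, hs, rfl⟩ hlt
    have hre : (Z s).re ≤ ε / 2 :=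
      (Complex.re_le_norm _).trans (hlt.le.trans (min_le_right _ _))
    by_cases h1 : s ≤ ε
    · exact ⟨⟨hb₂.re_nonneg ⟨hs.1, h1⟩, hre⟩, Or.inr (hgr₂ s ⟨hs.1, h1⟩ hre)⟩
    by_cases h2 : L - ε ≤ s
    · have hm : L - s ∈ Icc 0 ε := ⟨by linarith [hs.2], by linarith⟩
      have e1 := hb₁.re_nonneg hm
      have e2 := hgr₁ (L - s) hm
      simp only [sub_sub_cancel] at e1 e2
      exact ⟨⟨e1, hre⟩, Or.inl (e2 hre)⟩
    · have hm : Z s ∈ Metric.ball (0 : ℂ) r := by simpa using hlt.trans_le (min_le_left _ _)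
      exact absurd ⟨s, ⟨(not_le.1 h1).le, (not_le.1 h2).le⟩, rfl⟩ (hball hm)
  -- the outgoing branch is below the incoming one
  have horder : ∀ x ∈ Ioc 0 (ε / 2), f₂ x < f₁ x := by
    by_contra! hcon
    obtain ⟨x₀, hx₀, hle⟩ := hcon
    have hall : ∀ x ∈ Ioc 0 (ε / 2), f₁ x < f₂ x := by
      intro x hx
      by_contra! hle'
      have hc : ContinuousOn (fun x => f₂ x - f₁ x) (Ioc 0 (ε / 2)) :=
        ((hcont f₂ hlip₂).sub (hcont f₁ hlip₁)).mono Ioc_subset_Icc_self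
      obtain ⟨y, hy, hy0⟩ := isPreconnected_Ioc.intermediate_value hx hx₀ hc
        (show (0 : ℝ) ∈ Icc _ _ from ⟨by linarith, by linarith⟩)
      exact hne y hy (by simp only at hy0; linarith)
    -- The incoming velocity is close to -1, so its left normal points down. With the incoming
    -- branch lowest, enclosed points would lie below both graphs and be connected to `-r`, which is
    -- not enclosed.
    obtain ⟨x, hx0, hxlt⟩ := exists_between (show (0 : ℝ) < δ / 2 from half_pos hδ)
    obtain ⟨s, hs, hsx⟩ := hon₁ x ⟨hx0.le, by linarith⟩
    have hs0 : 0 < s := by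
      refine lt_of_le_of_ne hs.1 ?_
      rintro rfl
      have := congrArg Complex.re hsx
      simp only [sub_zero, hZL, Complex.zero_re] at this
      exact hx0.ne this
    have hW1 := hbd _ (hB₁' s hs)
    simp only [Complex.neg_re, Complex.neg_im, abs_neg] at hW1
    have hc : Continuous fun h : ℝ => Z (L - s) + h * (Complex.I * W (L - s)) := by fun_prop
    have hre : ∀ h : ℝ, (Z (L - s) + h * (Complex.I * W (L - s))).re =
        x - h * (W (L - s)).im := fun h => by
      rw [hsx]; simp; ring
    have him : ∀ h : ℝ, (Z (L - s) + h * (Complex.I * W (L - s))).im =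
        f₁ x + h * (W (L - s)).re := fun h => by
      rw [hsx]; simp
    have hxf := hcone f₁ hf₁0 hlip₁ x ⟨hx0.le, by linarith⟩
    have hev1 : ∀ᶠ h : ℝ in 𝓝[>] 0, ‖Z (L - s) + h * (Complex.I * W (L - s))‖ < δ := by
      refine Filter.Eventually.filter_mono nhdsWithin_le_nhds
        (hc.norm.continuousAt.eventually_lt_const ?_)
      simp only [Complex.ofReal_zero, zero_mul, add_zero, hsx]
      refine (Complex.norm_le_abs_re_add_abs_im _).trans_lt ?_
      simp only [abs_of_pos hx0]
      linarith
    have hcr : Continuous fun h : ℝ => x - h * (W (L - s)).im := by fun_prop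
    have hev2 : ∀ᶠ h : ℝ in 𝓝[>] 0, 0 < x - h * (W (L - s)).im := by
      refine Filter.Eventually.filter_mono nhdsWithin_le_nhds
        (hcr.continuousAt.eventually_const_lt ?_)
      simpa using hx0
    have hev3 : ∀ᶠ h : ℝ in 𝓝[>] 0, x - h * (W (L - s)).im < δ / 2 := by
      refine Filter.Eventually.filter_mono nhdsWithin_le_nhds
        (hcr.continuousAt.eventually_lt_const ?_)
      simpa using hxlt
    have hev4 : ∀ᶠ h : ℝ in 𝓝[>] 0, h < δ :=
      Filter.Eventually.filter_mono nhdsWithin_le_nhds (Iio_mem_nhds hδ)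
    obtain ⟨r, hrE, hr4, hr0⟩ := (hext.and (hev4.and self_mem_nhdsWithin)).exists
    obtain ⟨h, hhE, h1, h2, h3, hh0⟩ := ((hpos (L - s) ⟨by linarith [hs.2], by linarith⟩).and
      (hev1.and (hev2.and (hev3.and self_mem_nhdsWithin)))).exists
    replace hh0 : 0 < h := hh0
    have hxm : x - h * (W (L - s)).im ∈ Icc 0 (ε / 2) := ⟨h2.le, by linarith⟩
    -- A step `h` along the normal lowers the point by at least h/2 and shifts it sideways by at
    -- most h/4, over which the graph changes by at most h/8.
    have hlow : f₁ x + h * (W (L - s)).re < f₁ (x - h * (W (L - s)).im) := by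
      have e := hlip₁ x ⟨hx0.le, by linarith⟩ _ hxm
      rw [sub_sub_cancel, abs_mul, abs_of_pos hh0] at e
      have e' := (abs_le.1 e).2
      nlinarith [hW1.1, hW1.2]
    obtain ⟨P, hP, hPK, hwP, hrP⟩ := exists_isPreconnected_below_graphs hK
      (hcone f₁ hf₁0 hlip₁) (hcone f₂ hf₂0 hlip₂) h1 (by rw [hre]; exact h2)
      (by rw [hre]; exact hxm.2) (by rw [hre]; linarith) (by rw [hre, him]; exact hlow)
      (by rw [hre, him]; exact hlow.trans (hall _ ⟨h2, hxm.2⟩)) hr0 hr4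
    exact hrE (hE P hP hPK _ hrP _ hwP hhE)
  obtain ⟨δ₃, hδ₃, hd₃⟩ := Metric.continuousWithinAt_iff.1 (hZc 0 (left_mem_Icc.2 hL.le)) (ε / 2) hX
  have hη1 := min_le_left ε (δ₃ / 2)
  have hη2 := min_le_right ε (δ₃ / 2)
  refine ⟨min ε (δ₃ / 2), lt_min hε (half_pos hδ₃), by linarith, fun s hs t ht hst => ?_,
    fun s hs t ht hst => ?_, fun s hs t ht hst => ?_⟩
  · have ht' : t ∈ Icc 0 ε := ⟨ht.1, ht.2.trans hη1⟩
    have hs' : L - s ∈ Icc 0 ε := ⟨by linarith [hs.2], by linarith [hs.1]⟩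
    have hsm : (Z t).re ≤ ε / 2 := by
      have := hd₃ (x := t) ⟨ht.1, by linarith [ht'.2]⟩
        (by rw [Real.dist_eq, abs_lt]; constructor <;> linarith [ht.1, ht.2])
      rw [hZ0, dist_zero_right] at this
      exact (Complex.re_le_norm _).trans this.le
    have e1 := hgr₁ (L - s) hs'
    simp only [sub_sub_cancel] at e1
    rw [hgr₂ t ht' hsm, e1 (hst.trans_le hsm), hst]
    rcases eq_or_lt_of_le (hb₂.re_nonneg ht') with h0 | h0
    · rw [← h0, hf₁0, hf₂0]
    · exact (horder _ ⟨h0, hsm⟩).le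
  · have := hb₂.half_sub_le ⟨hs.1, hs.2.trans hη1⟩ ⟨ht.1, ht.2.trans hη1⟩ hst.le
    linarith
  · have := hb₁.half_sub_le (s := L - t) (t := L - s) ⟨by linarith [ht.2], by linarith [ht.1]⟩
      ⟨by linarith [hs.2], by linarith [hs.1]⟩ (by linarith)
    simp only [sub_sub_cancel] at this
    linarith

/-! ### Continuing the closed curve past its base point -/

theorem hasDerivWithinAt_Icc_glue {f f' : ℝ → ℂ} {u c v : ℝ} (huc : u ≤ c) (hcv : c ≤ v)
    (h₁ : ∀ s ∈ Icc u c, HasDerivWithinAt f (f' s) (Icc u c) s)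
    (h₂ : ∀ s ∈ Icc c v, HasDerivWithinAt f (f' s) (Icc c v) s) :
    ∀ s ∈ Icc u v, HasDerivWithinAt f (f' s) (Icc u v) s := by
  intro s hs
  rcases lt_trichotomy s c with hlt | rfl | hlt
  · refine (h₁ s ⟨hs.1, hlt.le⟩).mono_of_mem_nhdsWithin ?_
    filter_upwards [self_mem_nhdsWithin, mem_nhdsWithin_of_mem_nhds (Iio_mem_nhds hlt)] with x hx hx'
    exact ⟨hx.1, le_of_lt hx'⟩
  · rw [← Icc_union_Icc_eq_Icc huc hcv]
    exact (h₁ s ⟨huc, le_rfl⟩).union (h₂ s ⟨le_rfl, hcv⟩)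
  · refine (h₂ s ⟨hlt.le, hs.2⟩).mono_of_mem_nhdsWithin ?_
    filter_upwards [self_mem_nhdsWithin, mem_nhdsWithin_of_mem_nhds (Ioi_mem_nhds hlt)] with x hx hx'
    exact ⟨le_of_lt hx', hx.2⟩

section
variable {α : Type*} {L : ℝ} (hL : 0 < L) {f : ℝ → α}
include hL

theorem periodize_of_mem_Icc (hf : f 0 = f L) {s : ℝ} (hs : s ∈ Icc 0 L) :
    periodize L f s = f s := by
  rcases eq_or_lt_of_le hs.2 with heq | hlt
  · have := periodic_periodize hL f 0
    rw [zero_add] at this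
    rw [heq, this, periodize_of_mem_Ico hL f ⟨le_rfl, hL⟩, hf]
  · exact periodize_of_mem_Ico hL f ⟨hs.1, hlt⟩

theorem periodize_eq_sub (s : ℝ) : periodize L f s = periodize L f (s - L) :=
  ((periodic_periodize hL f).sub_eq s).symm

end

namespace IsAdmissible
variable {γ : ℝ → Plane} {L : ℝ} (h : IsAdmissible γ L)
include h

theorem periodize_ne {s t : ℝ} (hst : s < t) (htL : t < s + L) :
    periodize L γ s ≠ periodize L γ t := by
  obtain ⟨n, hn, hn'⟩ := exists_periodize_eq (α := Plane) h.length_pos s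
  obtain ⟨m, hm, hm'⟩ := exists_periodize_eq (α := Plane) h.length_pos t
  rw [hn' γ s hn, hm' γ t hm]
  intro heq
  have hL := h.length_pos
  have := h.simple hn hm heq
  -- Equal points give `t - s = (m - n) * L`, but no integer lies strictly between 0 and 1.
  have h1 : (0 : ℝ) < ((m - n : ℤ) : ℝ) := by push_cast; nlinarith
  have h2 : ((m - n : ℤ) : ℝ) < ((1 : ℤ) : ℝ) := by push_cast; nlinarith
  have h1' := Int.cast_pos.1 h1
  have h2' := Int.cast_lt.1 h2
  omega

theorem periodize_curve {s : ℝ} (hs : s ∈ Icc 0 L) : periodize L γ s = γ s :=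
  periodize_of_mem_Icc h.length_pos h.closes hs

theorem periodize_curve_sub {s : ℝ} (hs : s ∈ Icc L (2 * L)) : periodize L γ s = γ (s - L) := by
  rw [periodize_eq_sub h.length_pos, h.periodize_curve ⟨by linarith [hs.1], by linarith [hs.2]⟩]

theorem norm_periodize_tangent (s : ℝ) : ‖periodize L (tangent γ L) s‖ = 1 := by
  obtain ⟨n, hn, hn'⟩ := exists_periodize_eq (α := Plane) h.length_pos s
  rw [hn' _ s hn]
  exact h.arclength _ (Ico_subset_Icc_self hn)

theorem hasDerivWithinAt_toComplex {s : ℝ} (hs : s ∈ Icc 0 L) :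
    HasDerivWithinAt (fun s => toComplex (periodize L γ s)) (toComplex (tangent γ L s))
      (Icc 0 L) s := by
  have h1 : HasDerivWithinAt (fun s => toComplex (γ s)) (toComplex (tangent γ L s)) (Icc 0 L) s :=
    toComplex.toContinuousLinearEquiv.toContinuousLinearMap.hasFDerivAt.comp_hasDerivWithinAt s
      (h.hasDerivWithinAt hs)
  exact h1.congr (fun x hx => by rw [h.periodize_curve hx]) (by rw [h.periodize_curve hs])

theorem hasDerivWithinAt_toComplex_sub {s : ℝ} (hs : s ∈ Icc L (2 * L)) :
    HasDerivWithinAt (fun s => toComplex (periodize L γ s)) (toComplex (tangent γ L (s - L)))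
      (Icc L (2 * L)) s := by
  have hs' : s - L ∈ Icc 0 L := ⟨by linarith [hs.1], by linarith [hs.2]⟩
  have h0 : HasDerivWithinAt (fun x => x - L) 1 (Icc L (2 * L)) s :=
    (hasDerivWithinAt_id s _).sub_const L
  have h1 := (h.hasDerivWithinAt_toComplex hs').scomp s h0
    (fun x hx => show x - L ∈ Icc 0 L from ⟨by linarith [hx.1], by linarith [hx.2]⟩)
  rw [one_smul] at h1
  refine h1.congr (fun x hx => ?_) ?_ <;>
    simp only [Function.comp, ← periodize_eq_sub h.length_pos]

theorem toComplex_tangent_zero :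
    ∃ τ : ℝ, toComplex (tangent γ L 0) = Complex.exp (τ * Complex.I) := by
  refine ⟨Complex.arg (toComplex (tangent γ L 0)), ?_⟩
  have := Complex.norm_mul_exp_arg_mul_I (toComplex (tangent γ L 0))
  rw [LinearIsometryEquiv.norm_map, h.arclength 0 (left_mem_Icc.2 h.length_pos.le),
    Complex.ofReal_one, one_mul] at this
  exact this.symm

theorem arcCurvature_sub (s : ℝ) : arcCurvature γ L 0 (s - L) = arcCurvature γ L L s := by
  rw [arcCurvature, arcCurvature]
  have := intervalIntegral.integral_comp_add_right (a := 0) (b := s - L)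
    (periodize L (curvature γ L)) L
  rw [zero_add, sub_add_cancel] at this
  rw [← this]
  exact intervalIntegral.integral_congr fun x _ =>
    (periodic_periodize h.length_pos (curvature γ L) x).symm

theorem continuous_arcCurvature_right (a : ℝ) : Continuous fun s => arcCurvature γ L a s :=
  (continuous_arcCurvature h.intervalIntegrable_periodize).comp (by fun_prop : Continuous fun s => (a, s))

end IsAdmissible

/-! ### Excluding a return behind the starting point -/

/-- A smooth closed curve has no arc that returns to its initial tangent line behind its starting
point from the right-hand side. -/
theorem MemKpi.not_returns_behind {γ : ℝ → Plane} {L a b : ℝ} (h : MemKpi γ L) (ha : a ∈ Ico 0 L)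
    (hb : b ∈ Ioo a (a + L))
    (h_line : inner ℝ (periodize L γ b - γ a) (normal γ L a) = 0)
    (h_side : ∀ s ∈ Ioo a b, inner ℝ (periodize L γ s - γ a) (normal γ L a) < 0) :
    ¬ inner ℝ (periodize L γ b - γ a) (tangent γ L a) < 0 := by
  intro hlt
  have hadm := h.toIsAdmissible
  have hL := hadm.length_pos
  have ha' := Ico_subset_Icc_self ha
  have hTc : tangent γ L 0 = tangent γ L L := h.smooth_closing
  obtain ⟨τ, hτ⟩ := hadm.toComplex_tangent_zero
  have hpa : periodize L γ a = γ a := hadm.periodize_curve ha'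
  have hTa : periodize L (tangent γ L) a = tangent γ L a := periodize_of_mem_Ico hL _ ha
  have hderiv : ∀ s ∈ Icc 0 (2 * L), HasDerivWithinAt (fun s => toComplex (periodize L γ s))
      (toComplex (periodize L (tangent γ L) s)) (Icc 0 (2 * L)) s := by
    refine hasDerivWithinAt_Icc_glue hL.le (by linarith) (fun s hs => ?_) (fun s hs => ?_)
    · rw [periodize_of_mem_Icc hL hTc hs]
      exact hadm.hasDerivWithinAt_toComplex hs
    · rw [periodize_eq_sub hL, periodize_of_mem_Icc hL hTc
        ⟨by linarith [hs.1], by linarith [hs.2]⟩]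
      exact hadm.hasDerivWithinAt_toComplex_sub hs
  have hsub : Icc a b ⊆ Icc 0 (2 * L) := Icc_subset_Icc ha.1 (by linarith [hb.2, ha.2])
  have hangle : ∀ s ∈ Icc a b, toComplex (periodize L (tangent γ L) s) =
      Complex.exp (((arcCurvature γ L 0 s + τ : ℝ) : ℂ) * Complex.I) := by
    intro s hs
    have hs' := hsub hs
    have key : ∀ x ∈ Icc 0 L, toComplex (tangent γ L x) =
        Complex.exp (((arcCurvature γ L 0 x + τ : ℝ) : ℂ) * Complex.I) := fun x hx => by
      rw [hadm.toComplex_tangent hx, hτ, ← Complex.exp_add]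
      congr 1
      push_cast
      ring
    rcases le_total s L with hsL | hsL
    · rw [periodize_of_mem_Icc hL hTc ⟨hs'.1, hsL⟩, key s ⟨hs'.1, hsL⟩]
    · have hm : s - L ∈ Icc 0 L := ⟨by linarith, by linarith [hs'.2]⟩
      -- The smooth closing makes the total curvature of a full turn a multiple of 2π, so the angle
      -- formula continues into the second turn.
      have h1 := hadm.toComplex_tangent (right_mem_Icc.2 hL.le)
      rw [← hTc, eq_comm, mul_eq_left₀ (by rw [hτ]; exact Complex.exp_ne_zero _)] at h1
      have h2 : arcCurvature γ L 0 s = arcCurvature γ L 0 L + arcCurvature γ L 0 (s - L) := by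
        rw [hadm.arcCurvature_sub, arcCurvature_add hadm.intervalIntegrable_periodize]
      rw [periodize_eq_sub hL, periodize_of_mem_Icc hL hTc hm, key _ hm, h2, add_assoc,
        Complex.ofReal_add (arcCurvature γ L 0 L), add_mul, Complex.exp_add, h1, one_mul]
  have hnorm := hadm.arclength a ha'
  have hturn := turning_le_of_smooth hb.1
    (Γ := fun s => toComplex (periodize L γ s))
    (T := fun s => toComplex (periodize L (tangent γ L) s))
    (fun s hs => by rw [hangle s hs]; exact Complex.exp_ne_zero _)
    (fun s hs => (hderiv s (hsub hs)).mono hsub)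
    (fun s hs t ht hst heq => hadm.periodize_ne hst (by linarith [hs.1, ht.2, hb.2])
      (toComplex.injective heq))
    (fun t ht => by
      rw [← map_sub, hTa, hpa, toComplex_div_im hnorm]
      exact h_side t ht)
    (by rw [← map_sub, hTa, hpa, toComplex_div_im hnorm]; exact h_line)
    (by rw [← map_sub, hTa, hpa, toComplex_div_re hnorm]; exact hlt)
    (hadm.continuous_arcCurvature_right 0).continuousOn τ hangle
  have hgt := neg_pi_lt_arcCurvature (isArcFamily_arcK L) hadm.intervalIntegrable_periodize
    hadm.periodize_curvature_pos_right hb.1 ⟨hb.1, hb.2.le⟩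
    (fun c d _ _ hm => h.convex_arcs c d hm) (fun c d hm => (h.concave_arcs c d hm).1)
  linarith [arcCurvature_add hadm.intervalIntegrable_periodize 0 a b]

/-- Only convex arcs strictly inside `[a, b]` need a bound, and these do not end at the cusp. -/
theorem MemCpi.neg_pi_lt_arcCurvature {γ : ℝ → Plane} {L a b : ℝ} (h : MemCpi γ L) (ha : 0 ≤ a)
    (hab : a < b) (hb : b ≤ L) : -Real.pi < arcCurvature γ L a b :=
  PlaneCurve.neg_pi_lt_arcCurvature (isArcFamily_arcC L)
    h.toIsAdmissible.intervalIntegrable_periodize h.toIsAdmissible.periodize_curvature_pos_right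
    hab ⟨ha, hab, hb⟩
    (fun c d hc hd hm => h.convex_arcs c d hm (ha.trans_lt hc).ne' (hd.trans_le hb).ne)
    (fun c d hm => (h.concave_arcs c d hm).1)

/-- Near an external cusp no chord points in the direction of the normal at the cusp. -/
theorem MemC.exists_chord_avoids_normal {γ : ℝ → Plane} {L : ℝ} (h : MemC γ L) :
    ∃ ε > 0, ∀ s ∈ Icc (L - ε) (L + ε), ∀ t ∈ Icc (L - ε) (L + ε), s < t →
      ¬ (((toComplex (periodize L γ t) - toComplex (periodize L γ s)) /
          toComplex (tangent γ L 0)).re = 0 ∧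
        0 < ((toComplex (periodize L γ t) - toComplex (periodize L γ s)) /
          toComplex (tangent γ L 0)).im) := by
  have hadm := h.toIsAdmissible
  have hL := hadm.length_pos
  set T₀ := toComplex (tangent γ L 0) with hT₀
  have hT₀' : T₀ ≠ 0 := by
    rw [hT₀, ← norm_ne_zero_iff, LinearIsometryEquiv.norm_map,
      hadm.arclength 0 (left_mem_Icc.2 hL.le)]
    exact one_ne_zero
  -- Coordinates with the cusp at 0 and outgoing tangent 1; `Ψ` transports them back to the plane.
  set Z : ℝ → ℂ := fun s => toComplex (γ s - γ 0) / T₀ with hZ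
  set W : ℝ → ℂ := fun s => toComplex (tangent γ L s) / T₀ with hW
  set Ψ : ℂ → Plane := fun z => γ 0 + toComplex.symm (z * T₀) with hΨ
  have hΨZ : ∀ s, Ψ (Z s) = γ s := fun s => by
    simp only [hΨ, hZ, div_mul_cancel₀ _ hT₀', LinearIsometryEquiv.symm_apply_apply,
      add_sub_cancel]
  have hΨinj : Function.Injective Ψ := fun z w hzw =>
    mul_right_cancel₀ hT₀' (toComplex.symm.injective (add_left_cancel hzw))
  have hΨc : Continuous Ψ := by fun_prop
  obtain ⟨η, hη, hηL, hA, hB, hC⟩ := exists_cusp_order (Z := Z) (W := W) hL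
    (fun s hs => by
      have h1 : HasDerivWithinAt (fun s => toComplex (γ s - γ 0)) (toComplex (tangent γ L s))
          (Icc 0 L) s :=
        toComplex.toContinuousLinearEquiv.toContinuousLinearMap.hasFDerivAt.comp_hasDerivWithinAt s
          ((hadm.hasDerivWithinAt hs).sub_const (γ 0))
      exact h1.div_const T₀)
    ((toComplex.continuous.comp_continuousOn hadm.continuousOn_tangent).div_const T₀)
    (div_self hT₀')
    (by
      have : tangent γ L L = -tangent γ L 0 := by rw [h.cusp, neg_neg]
      simp only [hW, this, map_neg, ← hT₀, neg_div, div_self hT₀'])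
    (by simp [hZ]) (by simp [hZ, ← hadm.closes])
    (fun s hs t ht heq => hadm.simple hs ht (by rw [← hΨZ s, ← hΨZ t, heq]))
    (E := fun z => Ψ z ∈ enclosed γ L)
    (fun s hs => by
      filter_upwards [hadm.positive s hs] with r hr
      convert hr using 1
      simp only [hΨ, hZ, hW]
      apply toComplex.injective
      rw [normal, map_add, map_add, LinearIsometryEquiv.apply_symm_apply, map_smul,
        toComplex_rot90, map_sub, Complex.real_smul]
      field_simp
      ring)
    (by
      filter_upwards [h.external] with r hr
      convert hr using 2
      have : tangent γ L L = -tangent γ L 0 := by rw [h.cusp, neg_neg]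
      rw [this, ← hadm.closes]
      apply toComplex.injective
      simp only [hΨ]
      rw [map_add, map_add, LinearIsometryEquiv.apply_symm_apply, map_smul, map_neg,
        Complex.real_smul, ← hT₀]
      ring)
    (fun P hP hPK z hz w hw hwE => by
      have hsub : Ψ '' P ⊆ (γ '' Icc 0 L)ᶜ := by
        rintro _ ⟨x, hx, rfl⟩ ⟨s, hs, hsx⟩
        rw [← hΨZ s] at hsx
        exact hPK hx ⟨s, hs, hΨinj hsx⟩
      have hconn := (hP.image Ψ hΨc.continuousOn).subset_connectedComponentIn
        (mem_image_of_mem Ψ hw) hsub (mem_image_of_mem Ψ hz)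
      refine ⟨hsub (mem_image_of_mem Ψ hz), ?_⟩
      rw [← connectedComponentIn_eq hconn]
      exact hwE.2)
  have hchord : ∀ x y : ℝ, (toComplex (γ y) - toComplex (γ x)) / T₀ = Z y - Z x := fun x y => by
    simp only [hZ, map_sub]
    ring
  refine ⟨η, hη, fun s hs t ht hst => ?_⟩
  rintro ⟨h1, h2⟩
  -- Within one branch the real part is strictly monotone, so no chord is vertical; a vertical chord
  -- from the incoming to the outgoing branch does not point up.
  rcases le_total t L with htL | htL
  · have hs' : s ∈ Icc (L - η) L := ⟨hs.1, hst.le.trans htL⟩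
    rw [hadm.periodize_curve ⟨by linarith [hs.1], hs'.2⟩,
      hadm.periodize_curve ⟨by linarith [ht.1], htL⟩, hchord, Complex.sub_re] at h1
    linarith [hC s hs' t ⟨ht.1, htL⟩ hst]
  · have ht' : t - L ∈ Icc 0 η := ⟨by linarith, by linarith [ht.2]⟩
    rw [hadm.periodize_curve_sub (s := t) ⟨htL, by linarith [ht.2]⟩] at h1 h2
    rcases le_total s L with hsL | hsL
    · rw [hadm.periodize_curve ⟨by linarith [hs.1], hsL⟩, hchord] at h1 h2
      rw [Complex.sub_re] at h1
      rw [Complex.sub_im] at h2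
      linarith [hA s ⟨hs.1, hsL⟩ (t - L) ht' (by linarith)]
    · rw [hadm.periodize_curve_sub (s := s) ⟨hsL, by linarith [hs.2]⟩, hchord,
        Complex.sub_re] at h1
      linarith [hB (s - L) ⟨by linarith, by linarith [hs.2]⟩ (t - L) ht' (by linarith)]

/-- The analogue of `MemKpi.not_returns_behind` for curves with an external cusp. -/
theorem MemCpi.not_returns_behind {γ : ℝ → Plane} {L a b : ℝ} (h : MemCpi γ L) (ha : a ∈ Ico 0 L)
    (hb : b ∈ Ioo a (a + L))
    (h_line : inner ℝ (periodize L γ b - γ a) (normal γ L a) = 0)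
    (h_side : ∀ s ∈ Ioo a b, inner ℝ (periodize L γ s - γ a) (normal γ L a) < 0) :
    ¬ inner ℝ (periodize L γ b - γ a) (tangent γ L a) < 0 := by
  intro hlt
  have hadm := h.toIsAdmissible
  have hL := hadm.length_pos
  have ha' := Ico_subset_Icc_self ha
  obtain ⟨τ, hτ⟩ := hadm.toComplex_tangent_zero
  have hpa : periodize L γ a = γ a := hadm.periodize_curve ha'
  have hTa : periodize L (tangent γ L) a = tangent γ L a := periodize_of_mem_Ico hL _ ha
  have hnorm := hadm.arclength a ha'
  have hadd := arcCurvature_add hadm.intervalIntegrable_periodize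
  have hinj : ∀ s ∈ Icc a b, ∀ t ∈ Icc a b, s < t →
      toComplex (periodize L γ s) ≠ toComplex (periodize L γ t) := fun s hs t ht hst heq =>
    hadm.periodize_ne hst (by linarith [hs.1, ht.2, hb.2]) (toComplex.injective heq)
  have hangle : ∀ x ∈ Icc 0 L, toComplex (tangent γ L x) =
      Complex.exp (((arcCurvature γ L 0 x + τ : ℝ) : ℂ) * Complex.I) := fun x hx => by
    rw [hadm.toComplex_tangent hx, hτ, ← Complex.exp_add]
    congr 1
    push_cast
    ring
  rcases le_or_gt b L with hbL | hbL
  · have hsub : Icc a b ⊆ Icc 0 L := Icc_subset_Icc ha.1 hbL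
    have hturn := turning_le_of_smooth hb.1
      (Γ := fun s => toComplex (periodize L γ s)) (T := fun s => toComplex (tangent γ L s))
      (fun s hs => by rw [hangle s (hsub hs)]; exact Complex.exp_ne_zero _)
      (fun s hs => (hadm.hasDerivWithinAt_toComplex (hsub hs)).mono hsub) hinj
      (fun t ht => by
        rw [← map_sub, hpa, toComplex_div_im hnorm]
        exact h_side t ht)
      (by rw [← map_sub, hpa, toComplex_div_im hnorm]; exact h_line)
      (by rw [← map_sub, hpa, toComplex_div_re hnorm]; exact hlt)
      (hadm.continuous_arcCurvature_right 0).continuousOn τ (fun s hs => hangle s (hsub hs))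
    linarith [h.neg_pi_lt_arcCurvature ha.1 hb.1 hbL, hadd 0 a b]
  · have hb2 : b ≤ 2 * L := by linarith [hb.2, ha.2]
    have hcusp : Complex.exp ((arcCurvature γ L 0 L : ℂ) * Complex.I) = -1 := by
      have h1 := hadm.toComplex_tangent (right_mem_Icc.2 hL.le)
      have h2 : tangent γ L L = -tangent γ L 0 := by rw [h.cusp, neg_neg]
      have hne : toComplex (tangent γ L 0) ≠ 0 := by rw [hτ]; exact Complex.exp_ne_zero _
      rw [h2, map_neg] at h1
      refine mul_left_cancel₀ hne ?_
      rw [← h1]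
      ring
    have hsub : Icc L b ⊆ Icc L (2 * L) := Icc_subset_Icc_right hb2
    have hT₂ : ∀ s ∈ Icc L b, periodize L (tangent γ L) s = tangent γ L (s - L) := fun s hs => by
      rw [periodize_eq_sub hL, periodize_of_mem_Ico hL _
        ⟨by linarith [hs.1], by linarith [hs.2, hb.2, ha.2]⟩]
    -- At `L` the periodized tangent has the outgoing value; the incoming one enters only as a limit
    -- from the left.
    have hTL : periodize L (tangent γ L) L = tangent γ L 0 := by
      rw [hT₂ L ⟨le_rfl, hbL.le⟩, sub_self]
    have hturn := turning_le_of_cusp ha.2 hbL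
      (Γ := fun s => toComplex (periodize L γ s))
      (T := fun s => toComplex (periodize L (tangent γ L) s))
      (fun s _ => by
        rw [← norm_ne_zero_iff, LinearIsometryEquiv.norm_map, hadm.norm_periodize_tangent]
        exact one_ne_zero)
      (by
        have hc : ∀ s ∈ Icc 0 (2 * L), ContinuousWithinAt (fun s => toComplex (periodize L γ s))
            (Icc 0 (2 * L)) s := by
          intro s hs
          rw [← Icc_union_Icc_eq_Icc hL.le (by linarith : L ≤ 2 * L)]
          have c1 : ContinuousOn (fun s => toComplex (periodize L γ s)) (Icc 0 L) := fun x hx =>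
            (hadm.hasDerivWithinAt_toComplex hx).continuousWithinAt
          have c2 : ContinuousOn (fun s => toComplex (periodize L γ s)) (Icc L (2 * L)) :=
            fun x hx => (hadm.hasDerivWithinAt_toComplex_sub hx).continuousWithinAt
          refine (c1.union_of_isClosed c2 isClosed_Icc isClosed_Icc) s ?_
          rwa [Icc_union_Icc_eq_Icc hL.le (by linarith : L ≤ 2 * L)]
        exact ContinuousOn.mono hc (Icc_subset_Icc ha.1 hb2))
      (fun u hu s hs => by
        have hs' : s ∈ Ico 0 L := ⟨ha.1.trans hs.1, hs.2.trans_lt hu⟩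
        rw [periodize_of_mem_Ico hL (tangent γ L) hs']
        exact (hadm.hasDerivWithinAt_toComplex (Ico_subset_Icc_self hs')).mono
          (Icc_subset_Icc ha.1 hu.le))
      (fun s hs => by
        rw [hT₂ s hs]
        exact (hadm.hasDerivWithinAt_toComplex_sub (hsub hs)).mono hsub)
      hinj
      (fun t ht => by
        rw [← map_sub, hTa, hpa, toComplex_div_im hnorm]
        exact h_side t ht)
      (by rw [← map_sub, hTa, hpa, toComplex_div_im hnorm]; exact h_line)
      (by rw [← map_sub, hTa, hpa, toComplex_div_re hnorm]; exact hlt)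
      -- Normalized to have the values π and 2π at the cusp, relative to the angle `τ` of the
      -- outgoing tangent.
      (Θ₁ := fun s => arcCurvature γ L 0 s - arcCurvature γ L 0 L + Real.pi)
      (Θ₂ := fun s => arcCurvature γ L L s + 2 * Real.pi)
      (((hadm.continuous_arcCurvature_right 0).sub continuous_const).add
        continuous_const).continuousOn
      ((hadm.continuous_arcCurvature_right L).add continuous_const).continuousOn τ
      (fun s hs => by
        have hs' : s ∈ Ico 0 L := ⟨ha.1.trans hs.1, hs.2⟩
        rw [periodize_of_mem_Ico hL (tangent γ L) hs', hangle s (Ico_subset_Icc_self hs')]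
        have : (((arcCurvature γ L 0 s - arcCurvature γ L 0 L + Real.pi + τ : ℝ) : ℂ) *
            Complex.I) = ((arcCurvature γ L 0 s + τ : ℝ) : ℂ) * Complex.I -
              (arcCurvature γ L 0 L : ℂ) * Complex.I + Real.pi * Complex.I := by
          push_cast
          ring
        rw [this, Complex.exp_add, Complex.exp_sub, hcusp, Complex.exp_pi_mul_I]
        ring)
      (fun s hs => by
        have hs' : s - L ∈ Icc 0 L := ⟨by linarith [hs.1], by linarith [hs.2]⟩
        rw [hT₂ s hs, hangle _ hs', hadm.arcCurvature_sub, Complex.exp_eq_exp_iff_exists_int]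
        exact ⟨-1, by push_cast; ring⟩)
      (by simp)
      (by simp [arcCurvature])
      (by
        rw [hTL]
        exact h.toMemC.exists_chord_avoids_normal)
    -- The turning bound reads K(a, L) + π + K(L, b) ≤ -π for the total curvatures K, while both
    -- exceed -π.
    have h1 := h.neg_pi_lt_arcCurvature ha.1 ha.2 le_rfl
    have h2 := h.neg_pi_lt_arcCurvature (a := 0) (b := b - L) le_rfl (by linarith)
      (by linarith)
    rw [hadm.arcCurvature_sub] at h2
    linarith [hadd 0 a L, Real.pi_pos]

end PlaneCurve

end

/-- The arc runs from `p = γ(a)`, where `a ∈ [0, L)`, to `q = γ(b)`, where `a < b < a + L`, along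
the periodized curve. -/
theorem mainTheorem8 (γ : ℝ → PlaneCurve.Plane) (L a b : ℝ)
    (hγ : PlaneCurve.MemKpi γ L ∨ (PlaneCurve.MemCpi γ L ∧ a ≠ 0))
    (ha : a ∈ Set.Ico 0 L) (hb : b ∈ Set.Ioo a (a + L))
    (p q : PlaneCurve.Plane) (hp : p = γ a) (hq : q = PlaneCurve.periodize L γ b)
    (h_line : inner ℝ (q - p) (PlaneCurve.normal γ L a) = 0)
    (h_side : ∀ s ∈ Set.Ioo a b,
      inner ℝ (PlaneCurve.periodize L γ s - p) (PlaneCurve.normal γ L a) < 0) :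
    ‖q - p‖⁻¹ • (q - p) = PlaneCurve.tangent γ L a := by
  have hadm : PlaneCurve.IsAdmissible γ L :=
    hγ.elim (fun h => h.toIsAdmissible) (fun h => h.1.toIsAdmissible)
  have hnot : ¬ inner ℝ (q - p) (PlaneCurve.tangent γ L a) < 0 := by
    subst hp hq
    exact hγ.elim (fun h => h.not_returns_behind ha hb h_line h_side)
      (fun h => h.1.not_returns_behind ha hb h_line h_side)
  have hnorm := hadm.arclength a (Set.Ico_subset_Icc_self ha)
  have hne : q - p ≠ 0 := by
    rw [hp, hq, sub_ne_zero, ← hadm.periodize_curve (Set.Ico_subset_Icc_self ha)]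
    exact (hadm.periodize_ne hb.1 hb.2).symm
  -- By `h_line` the vector `q - p` has no normal component; `hnot` then settles the sign of the
  -- factor.
  obtain ⟨r, hr⟩ : ∃ r : ℝ, q - p = r • PlaneCurve.tangent γ L a := by
    refine ⟨inner ℝ (q - p) (PlaneCurve.tangent γ L a), PlaneCurve.toComplex.injective ?_⟩
    have h0 : PlaneCurve.toComplex (PlaneCurve.tangent γ L a) ≠ 0 := by
      rw [← norm_ne_zero_iff, LinearIsometryEquiv.norm_map, hnorm]
      exact one_ne_zero
    rw [map_smul, Complex.real_smul, ← div_eq_iff h0]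
    refine Complex.ext ?_ ?_
    · rw [PlaneCurve.toComplex_div_re hnorm, Complex.ofReal_re]
    · rw [PlaneCurve.toComplex_div_im hnorm, Complex.ofReal_im]
      exact h_line
  rw [hr] at hnot hne ⊢
  rw [real_inner_smul_left, real_inner_self_eq_norm_sq, hnorm, one_pow, mul_one, not_lt] at hnot
  have hr0 : r ≠ 0 := fun h => hne (by rw [h, zero_smul])
  rw [norm_smul, hnorm, mul_one, Real.norm_eq_abs, abs_of_nonneg hnot, smul_smul,
    inv_mul_cancel₀ hr0, one_smul]
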